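/- **Notation.** Let $\gamma_0=(1,2,3)(4,5,6)(7,8,9)(10,11,12)$ and $\gamma_1=(3,4)(5,7)(8,10)(11,12)$, so that $M_{12}=\langle\gamma_0,\gamma_1\rangle\subset S_{12}$. The double cover $2.M_{12}\subset S_{24}$ is the group of permutations of the signed letters $\pm1,\dots,\pm12$ generated by $\tilde\gamma_0=(1,2,3)(4,5,6)(7,8,9)(10,11,12)(-1,-2,-3)(-4,-5,-6)(-7,-8,-9)(-10,-11,-12)$ and $\tilde\gamma_1=(3,4)(5,7)(8,10)(11,-12)(-3,-4)(-5,-7)(-8,-10)(-11,12)$. The group $M_{12}.2=\mathrm{Aut}(M_{12})\subset S_{24}$ acts on the letters $1,\dots,12,\bar1,\dots,\bar{12}$ and is generated by $\gamma_0\bar\gamma_0^{-1}$, $\gamma_1\bar\gamma_1^{-1}$ and the involution $e\leftrightarrow\bar e$ (a bar over a permutation means the same permutation of the barred letters). The group $(2.M_{12}.2)^*\subset S_{48}$, the isoclinic variant of the Atlas double cover $2.M_{12}.2$ of $M_{12}.2$, acts on the letters $\pm e,\pm\bar e$ and is generated by $\tilde\gamma_0\bar{\tilde\gamma}_0^{-1}$,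 $\tilde\gamma_1\bar{\tilde\gamma}_1^{-1}$ and $e\mapsto\bar e\mapsto-e\mapsto-\bar e\mapsto e$. Forgetting signs gives the projections $2.M_{12}\to M_{12}$ and $(2.M_{12}.2)^*\to M_{12}.2$. Let $2A$ be the conjugacy class of $M_{12}$ that consists of the elements of cycle type $2^6$, and let $2C$ be the conjugacy class of $e\leftrightarrow\bar e$ in $M_{12}.2$. With $a=\sqrt{-5}$ and $u=\sqrt{-11}$ put $$f_A(t,x)=5^3(24ax^2+16ax-648a-x^4-60x^3-870x^2-220x+6399)^3-2^{12}3^{15}(118a-475)tx^2,$$ $$f_C(t,x)=(21ux+13u-2x^3-54x^2-321x-83)^3(69ux+1573u-2x^3-102x^2-1713x-10043)+2^93^{12}(253u+67)tx,$$ $$f_D(t,x)=-11^2u(1188ux^3+198ux^2-1346ux-27u+594x^4-7920x^2-1474x+135)^3-2^83^{13}(253u-67)tx,$$ and $f_{L2}=f_L\overline{f_L}\in\mathbb Z[t,x]$ for $L\in\{A,C,D\}$. Put $$P(x)=(x^6-20x^5+262x^4-15286x^3+477665x^2-10170814x+96944940)^3(x^6+60x^5+2406x^4+56114x^3+1941921x^2+55625130x+996578748),$$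 $$\begin{aligned}Q(x)={}&x^{12}+396x^{10}-27192x^9+933174x^8-20101752x^7+169737744x^6-16330240872x^5\\&+538400028969x^4-8234002812376x^3+195276967064388x^2-3991355037576144x+30911476378259268,\end{aligned}$$ $$b(x)=17393508x^6-76705370280x^4+805458568464x^3+33876587610756x^2-420738452841168x-541526382027576,$$ $$f_{E2}(t,x)=(1-t)P(x)+tQ(x)^2+2^43^{12}11^{22}t(t-1),\qquad f_E(s,x)=Q(x)+s\,b(x)+2^23^611^{10}s^2,$$ so that $f_{E2}(1+s^2/11,x)=f_E(s,x)f_E(-s,x)$. For $\tau\in\mathbb Q$ let $K(L,\tau)=\mathbb Q[x]/(f_L(\tau,x))$, where $L\in\{E,E2,A2,C2,D2\}$. Let $G_{\mathbb Q}$ be the absolute Galois group of $\mathbb Q$; it acts on the set of embeddings of a $\mathbb Q$-algebra $K$ into $\overline{\mathbb Q}\subset\mathbb C$. The Galois group of a number field means the Galois group of its Galois closure over $\mathbb Q$. An $M_{12}$ algebra is one of degree 12 whose embeddings can be labelled by $1,\dots,12$ in such a way that $G_{\mathbb Q}$ acts on them through a homomorphism $\rho:G_{\mathbb Q}\to M_{12}$.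 An $M_{12}.2$ field is one of degree 24 whose embeddings can be labelled by $1,\dots,12,\bar1,\dots,\bar{12}$ in such a way that $G_{\mathbb Q}$ acts on them with image $M_{12}.2\subset S_{24}$. **Theorem.** 1. The elements of $2.M_{12}$ above the class $2A$ all have order 4 (cycle type $4^6$ on the signed letters), and they form a single conjugacy class. 2. For every $\tau\in\mathbb Q$ and every labelling that makes $K(E,\tau)$ an $M_{12}$ algebra, with homomorphism $\rho:G_{\mathbb Q}\to M_{12}$, complex conjugation is mapped by $\rho$ into the class $2A$ (cycle type $2^6$), and $\rho$ does not lift to a homomorphism $G_{\mathbb Q}\to2.M_{12}$. 3. For every $\tau\in\mathbb Q$, the algebra $K(E,\tau)$ does not embed in a number field with Galois group isomorphic to $2.M_{12}$; indeed there is no $\mathbb Q$-algebra homomorphism from $K(E,\tau)$ to such a field. 4. The elements of $(2.M_{12}.2)^*$ above the class $2C$ all have order 4 (cycle type $4^{12}$ on the signed letters). 5. Let $L\in\{A,C,D\}$ and $\tau\in\mathbb Q\setminus\{0,1\}$, and let $K(L2,\tau)$ be an $M_{12}.2$ field. For every labelling as above, complex conjugation acts on the labels as an element of the class $2C$, and $K(L2,\tau)$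 does not embed in a number field with Galois group isomorphic to $(2.M_{12}.2)^*$. 6. Let $\tau\in\mathbb Q\setminus\{0,1\}$ and let $K(E2,\tau)$ be an $M_{12}.2$ field. Then $K(E2,\tau)$ does not embed in a number field with Galois group isomorphic to $(2.M_{12}.2)^*$. -/

import Mathlib

open Polynomial Equiv

noncomputable section

/-! ### The groups

`M₁₂` acts on the letters `Fin 12`; the letter `12` is written `(12 : Fin 12)`, i.e. it is `0`.
The double covers are realised by signed permutations, a signed letter `± e` being a pair
`(e, s)` with `s = ± 1`. -/

/-- The permutation `(1,2,3)(4,5,6)(7,8,9)(10,11,12)`. -/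
def gen0 : Perm (Fin 12) :=
  List.formPerm [1, 2, 3] * List.formPerm [4, 5, 6] * List.formPerm [7, 8, 9] *
    List.formPerm [10, 11, 12]

/-- The permutation `(3,4)(5,7)(8,10)(11,12)`. -/
def gen1 : Perm (Fin 12) :=
  swap 3 4 * swap 5 7 * swap 8 10 * swap 11 12

/-- The Mathieu group `M₁₂` in its action on twelve letters. -/
def M12 : Subgroup (Perm (Fin 12)) :=
  Subgroup.closure {gen0, gen1}

/-- Signed letters `± e`. -/
abbrev SignedLetter : Type := Fin 12 × ℤˣ

/-- The signed permutation `± e ↦ ± ε(e) σ(e)`. -/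
def signedPerm (σ : Perm (Fin 12)) (ε : Fin 12 → ℤˣ) : Perm SignedLetter where
  toFun p := (σ p.1, ε p.1 * p.2)
  invFun p := (σ.symm p.1, (ε (σ.symm p.1))⁻¹ * p.2)
  left_inv p := by ext <;> simp [← mul_assoc]
  right_inv p := by ext <;> simp [← mul_assoc]

/-- `(1,2,3)(4,5,6)(7,8,9)(10,11,12)(-1,-2,-3)(-4,-5,-6)(-7,-8,-9)(-10,-11,-12)`. -/
def gen0Tilde : Perm SignedLetter := signedPerm gen0 (fun _ => 1)

/-- `(3,4)(5,7)(8,10)(11,-12)(-3,-4)(-5,-7)(-8,-10)(-11,12)`. -/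
def gen1Tilde : Perm SignedLetter :=
  signedPerm gen1 (fun e => if e = 11 ∨ e = 12 then -1 else 1)

/-- The nonsplit double cover `2.M₁₂` of `M₁₂`, as a transitive group of degree `24`. -/
def M12Tilde : Subgroup (Perm SignedLetter) :=
  Subgroup.closure {gen0Tilde, gen1Tilde}

/-- The automorphism group `M₁₂.2` of `M₁₂`, as a transitive group of degree `24` on the letters
`e` (`Sum.inl e`) and `ē` (`Sum.inr e`). Here `M₁₂` acts on the letters `e` in the given way and on
the letters `ē` in its twin way, in which `gen0`, `gen1` act by their inverses, and the letters
`e`, `ē` are interchanged by an outer involution. -/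
def M12Dot2 : Subgroup (Perm (Fin 12 ⊕ Fin 12)) :=
  Subgroup.closure
    {Perm.sumCongr gen0 gen0⁻¹, Perm.sumCongr gen1 gen1⁻¹, Equiv.sumComm (Fin 12) (Fin 12)}

/-- The signed permutation `e ↦ ē ↦ -e ↦ -ē ↦ e`, of order `4`. -/
def starSwap : Perm (SignedLetter ⊕ SignedLetter) where
  toFun := Sum.elim (fun p => Sum.inr p) (fun p => Sum.inl (p.1, -p.2))
  invFun := Sum.elim (fun p => Sum.inr (p.1, -p.2)) (fun p => Sum.inl p)
  left_inv p := by rcases p with p | p <;> simp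
  right_inv p := by rcases p with p | p <;> simp

/-- The nonstandard (isoclinic) double cover `(2.M₁₂.2)*` of `M₁₂.2`, as a transitive group of
degree `48` on the signed letters `± e`, `± ē`.
The standard (Atlas) double cover `2.M₁₂.2` is generated in the same way, but with the involution
`± e ↔ ± ē` in the place of `starSwap`. Both contain `2.M₁₂` with index two. As `starSwap` induces
the same automorphism of `2.M₁₂` as that involution, and has square `-1` instead of `1`, passing
from one group to the other amounts to multiplying the outer elements by a central `√-1`. -/
def M12Dot2Star : Subgroup (Perm (SignedLetter ⊕ SignedLetter)) :=
  Subgroup.closure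
    {Perm.sumCongr gen0Tilde gen0Tilde⁻¹, Perm.sumCongr gen1Tilde gen1Tilde⁻¹, starSwap}

/-- `g'` lies above `g`, for permutations `g'` of signed letters and `g` of letters `e`. -/
def LiesAbove (g' : Perm SignedLetter) (g : Perm (Fin 12)) : Prop :=
  Function.Semiconj Prod.fst g' g

/-- `g'` lies above `g`, for permutations `g'` of signed letters and `g` of letters `e`, `ē`. -/
def LiesAbove₂ (g' : Perm (SignedLetter ⊕ SignedLetter)) (g : Perm (Fin 12 ⊕ Fin 12)) : Prop :=
  Function.Semiconj (Sum.map Prod.fst Prod.fst) g' g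

/-- An element of `M₁₂` of cycle type `2⁶`. -/
def rep2A : Perm (Fin 12) := (gen0 * gen1 * gen0 * gen1 * gen0⁻¹ * gen1) ^ 3

/-- The conjugacy class `2A` of `M₁₂`. -/
def class2A : Set (Perm (Fin 12)) := {g | ∃ h ∈ M12, h * rep2A * h⁻¹ = g}

/-- The conjugacy class `2C` of `M₁₂.2`: the class of the involution `e ↔ ē`. -/
def class2C : Set (Perm (Fin 12 ⊕ Fin 12)) :=
  {g | ∃ h ∈ M12Dot2, h * Equiv.sumComm (Fin 12) (Fin 12) * h⁻¹ = g}

/-! ### Galois action -/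

/-- The field `ℚ̄ ⊂ ℂ` of algebraic numbers. -/
abbrev QBar : Type := algebraicClosure ℚ ℂ

/-- The absolute Galois group of `ℚ`. -/
abbrev GalQ : Type := QBar ≃ₐ[ℚ] QBar

instance : IsAlgClosure ℚ QBar := algebraicClosure.isAlgClosure ℚ ℂ

instance : Normal ℚ QBar := IsAlgClosure.normal ℚ QBar

/-- Complex conjugation, as an element of the absolute Galois group of `ℚ`. -/
def complexConj : GalQ := (Complex.conjAe.restrictScalars ℚ).restrictNormal QBar

theorem complexConj_apply (z : QBar) : (complexConj z : ℂ) = (starRingEnd ℂ) (z : ℂ) :=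
  AlgEquiv.restrictNormal_commutes (Complex.conjAe.restrictScalars ℚ) QBar z

/-- The action of the absolute Galois group on the embeddings of a `ℚ`-algebra `K` into `ℚ̄`. -/
def galAction (K : Type*) [CommRing K] [Algebra ℚ K] : GalQ →* Perm (K →ₐ[ℚ] QBar) where
  toFun σ :=
    { toFun := fun φ => (σ : QBar →ₐ[ℚ] QBar).comp φ
      invFun := fun φ => (σ⁻¹ : GalQ).toAlgHom.comp φ
      left_inv := fun φ => AlgHom.ext fun x => σ.symm_apply_apply (φ x)
      right_inv := fun φ => AlgHom.ext fun x => σ.apply_symm_apply (φ x) }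
  map_one' := rfl
  map_mul' _ _ := rfl

/-- The Galois representation of a `ℚ`-algebra `K` whose embeddings into `ℚ̄` are labelled by
`ι`: the action of the absolute Galois group on the labels. -/
def galRep {ι K : Type*} [CommRing K] [Algebra ℚ K] (e : ι ≃ (K →ₐ[ℚ] QBar)) :
    GalQ →* Perm ι :=
  (e.symm.permCongrHom : Perm (K →ₐ[ℚ] QBar) →* Perm ι).comp (galAction K)

/-- The abstract group `G` is the Galois group of (the Galois closure of) the number field `F`. -/
def HasGaloisGroup (F : Type*) [Field F] [NumberField F] (G : Type*) [Group G] : Prop :=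
  Nonempty ((galAction F).range ≃* G)

/-! ### The polynomials and their specializations -/

/-- The polynomial `f_A(t,x)`, where `a = √-5`. -/
def polyA {R : Type*} [CommRing R] (a t x : R) : R :=
  5 ^ 3 * (24 * a * x ^ 2 + 16 * a * x - 648 * a - x ^ 4 - 60 * x ^ 3 - 870 * x ^ 2 - 220 * x
    + 6399) ^ 3 - 2 ^ 12 * 3 ^ 15 * (118 * a - 475) * t * x ^ 2

/-- The polynomial `f_C(t,x)`, where `u = √-11`. -/
def polyC {R : Type*} [CommRing R] (u t x : R) : R :=
  (21 * u * x + 13 * u - 2 * x ^ 3 - 54 * x ^ 2 - 321 * x - 83) ^ 3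
    * (69 * u * x + 1573 * u - 2 * x ^ 3 - 102 * x ^ 2 - 1713 * x - 10043)
    + t * 2 ^ 9 * 3 ^ 12 * (253 * u + 67) * x

/-- The polynomial `f_D(t,x)`, where `u = √-11`. -/
def polyD {R : Type*} [CommRing R] (u t x : R) : R :=
  -11 ^ 2 * u * (1188 * u * x ^ 3 + 198 * u * x ^ 2 - 1346 * u * x - 27 * u + 594 * x ^ 4
    - 7920 * x ^ 2 - 1474 * x + 135) ^ 3 - 2 ^ 8 * 3 ^ 13 * (253 * u - 67) * t * x

/-- The covers whose field of definition is imaginary quadratic. -/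
inductive ImaginaryCover
  | A
  | C
  | D

/-- The polynomial `f_{L2}(τ,x) ∈ ℚ[x]`, for `L = A, C, D`: the product of `f_L(τ,x)` and its
conjugate over `ℚ`. (`QuadraticAlgebra ℚ[X] (-5) 0` is `ℚ(√-5)[x]`, and `QuadraticAlgebra.norm`
is the product with the conjugate on coefficients.) -/
def polyL2 (L : ImaginaryCover) (τ : ℚ) : ℚ[X] :=
  match L with
  | .A => QuadraticAlgebra.norm
      (polyA ⟨0, 1⟩ (.C (C τ)) (.C X) : QuadraticAlgebra ℚ[X] (-5) 0)
  | .C => QuadraticAlgebra.norm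
      (polyC ⟨0, 1⟩ (.C (C τ)) (.C X) : QuadraticAlgebra ℚ[X] (-11) 0)
  | .D => QuadraticAlgebra.norm
      (polyD ⟨0, 1⟩ (.C (C τ)) (.C X) : QuadraticAlgebra ℚ[X] (-11) 0)

/-- The polynomial `f_{E2}(t,x)`, of degree `24` in `x`. -/
def polyE2 {R : Type*} [CommRing R] (t x : R) : R :=
  (1 - t) * (x ^ 6 - 20 * x ^ 5 + 262 * x ^ 4 - 15286 * x ^ 3 + 477665 * x ^ 2 - 10170814 * x
      + 96944940) ^ 3
    * (x ^ 6 + 60 * x ^ 5 + 2406 * x ^ 4 + 56114 * x ^ 3 + 1941921 * x ^ 2 + 55625130 * x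
      + 996578748)
  + t * (x ^ 12 + 396 * x ^ 10 - 27192 * x ^ 9 + 933174 * x ^ 8 - 20101752 * x ^ 7
      + 169737744 * x ^ 6 - 16330240872 * x ^ 5 + 538400028969 * x ^ 4 - 8234002812376 * x ^ 3
      + 195276967064388 * x ^ 2 - 3991355037576144 * x + 30911476378259268) ^ 2
  + 2 ^ 4 * 3 ^ 12 * 11 ^ 22 * t * (t - 1)

/-- The polynomial `f_E(s,x)`, of degree `12` in `x`. It is determined, up to the sign of `s`, by
`f_{E2}(1 + s²/11, x) = f_E(s,x) f_E(-s,x)`. -/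
def polyE {R : Type*} [CommRing R] (s x : R) : R :=
  (x ^ 12 + 396 * x ^ 10 - 27192 * x ^ 9 + 933174 * x ^ 8 - 20101752 * x ^ 7
      + 169737744 * x ^ 6 - 16330240872 * x ^ 5 + 538400028969 * x ^ 4 - 8234002812376 * x ^ 3
      + 195276967064388 * x ^ 2 - 3991355037576144 * x + 30911476378259268)
  + s * (17393508 * x ^ 6 - 76705370280 * x ^ 4 + 805458568464 * x ^ 3 + 33876587610756 * x ^ 2
      - 420738452841168 * x - 541526382027576)
  + 2 ^ 2 * 3 ^ 6 * 11 ^ 10 * s ^ 2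

theorem polyE_mul_polyE_neg {k : Type*} [Field k] [CharZero k] (s x : k) :
    polyE s x * polyE (-s) x = polyE2 (1 + s ^ 2 / 11) x := by
  simp only [polyE, polyE2]
  ring

/-- The algebra `K(E,τ) = ℚ[x]/(f_E(τ,x))`. -/
abbrev KE (τ : ℚ) : Type := AdjoinRoot (polyE (C τ) X : ℚ[X])

/-- The algebra `K(E2,τ) = ℚ[x]/(f_{E2}(τ,x))`. -/
abbrev KE2 (τ : ℚ) : Type := AdjoinRoot (polyE2 (C τ) X : ℚ[X])

/-- The algebra `K(L2,τ) = ℚ[x]/(f_{L2}(τ,x))`, for `L = A, C, D`. -/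
abbrev KL2 (L : ImaginaryCover) (τ : ℚ) : Type := AdjoinRoot (polyL2 L τ)

end

/-!
# Number fields with group `M₁₂` that do not lift to the double covers

Complex conjugation `c` is an involution, so a number field can only embed in a field whose group is
a double cover if `c` lifts to an element of order at most two. The theorem holds because the lifts
of the relevant classes have order four.

*Groups.* The involutions of `M₁₂` are the elements of the class `2A`, without fixed letters, and
the conjugates of `γ₁` (`involution_of_mem_M12`). This and the other facts on `M₁₂` that depend on
its order are read off from stabilizer chains, whose correctness is a finite computation with
permutations (`checkChain`). The double cover and its twin action preserve a Hadamard matrix of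
order `12`, viewed as a pairing of the signed letters `± e` and `± ē`. Hence the kernel of `2.M₁₂ →
M₁₂` is `{1, -1}` (`eq_one_or_eq_negOne`), and as `starSwap` changes the sign of the symmetric
extension of the pairing, no outer element of `(2.M₁₂.2)*` is an involution
(`mul_self_ne_one_of_outer`). The lifts of `2A` and of `2C` have square `-1`.

*No real embeddings.* The polynomial `f_E(s, x)` is a sum of two squares, the second one with a
positive factor (`polyE_eq`). The two squares vanish together only for finitely many real pairs `(s,
x)`, and none of these has a rational `s²` (`polyE_ne_zero_of_sq_eq_ratCast`). So complex
conjugation fixes no embedding of `K(E,τ)`, nor of `K(E2,τ)` when `τ > 1`; in an `M₁₂` labelling of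
`K(E,τ)` it is in `2A`.

*Abstract embeddings.* An isomorphism of a Galois group with `2.M₁₂` need not be related to the
given labels. This is overcome by `exists_fixed_of_mul_self`: in any action of `2.M₁₂` on at most
twelve points, all involutions have fixed points. Either the action is trivial, or an element of
order eleven acts as a cycle and forces `-1` to act trivially; an involution of `2.M₁₂` is, up to
`-1`, a conjugate of the lift of `γ₁`, a fourth power of an element of order eight, which would need
a number of points divisible by eight to act without fixed points. For `(2.M₁₂.2)*` one uses that
every homomorphism to `M₁₂.2` respects the subgroups of index two (`map_mem_M12Dot2Inner`).

*Outer complex conjugation.* The polynomial of `K(L2,τ)`, and that of `K(E2,τ)` when `τ < 1`, splits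
into two conjugate factors of degree at most twelve over an imaginary quadratic field. Automorphisms
that act on the labels by elements of `M₁₂` fix this field, since `M₁₂` is generated by elements of
odd order; complex conjugation does not, so it is outer (`galRep_complexConj_notMem_inner`). Outer
involutions are in the class `2C` (`mem_class2C`).
-/

/-! ### Stabilizer chains verified by sifting -/

section Sifting

variable {G X : Type*} [Group G]

/-- If left multiplication by the generators `S` permutes the cosets `u K`, `u ∈ T`, then these
cosets cover the group generated by `S`. -/
theorem exists_inv_mul_mem_of_closure [Finite G] {S T : Set G} {K : Subgroup G} (h1 : 1 ∈ T)
    (h : ∀ s ∈ S, ∀ u ∈ T, ∃ u' ∈ T, u'⁻¹ * (s * u) ∈ K) {g : G}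
    (hg : g ∈ Subgroup.closure S) : ∃ u ∈ T, u⁻¹ * g ∈ K := by
  rw [← Subgroup.mem_toSubmonoid, Subgroup.closure_toSubmonoid_of_finite] at hg
  induction hg using Submonoid.closure_induction_left with
  | one => exact ⟨1, h1, by simp [K.one_mem]⟩
  | mul_left s hs y _ ih =>
    obtain ⟨u, hu, huy⟩ := ih
    obtain ⟨u', hu', hs'⟩ := h s hs u hu
    refine ⟨u', hu', ?_⟩
    have := K.mul_mem hs' huy
    simpa [mul_assoc] using this

/-- One level of a stabilizer chain: generators of a group, a base point, and elements which carry
the base point to the points of its orbit. -/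
structure ChainLevel (G X : Type*) where
  /-- generators of the group at this level -/
  gens : List G
  /-- the point whose stabilizer is the next group -/
  base : X
  /-- elements carrying the base point to the points of its orbit -/
  trans : List G

/-- Sifting `g` through a chain: `g` is written as a product of elements of the successive
transversals. The argument `norm` evaluates a group element before it is used any further. -/
def sifts [DecidableEq G] [SMul G X] [DecidableEq X] (norm : G → (G → Bool) → Bool) :
    List (ChainLevel G X) → G → Bool
  | [], g => decide (g = 1)
  | l :: L, g => l.trans.any fun u =>
      decide (u • l.base = g • l.base) && norm (u⁻¹ * g) (sifts norm L)

theorem mem_of_sifts [DecidableEq G] [SMul G X] [DecidableEq X] {norm : G → (G → Bool) → Bool}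
    (hnorm : ∀ g k, norm g k = k g) {K : Subgroup G} :
    ∀ {L : List (ChainLevel G X)} {g : G}, (∀ l ∈ L, ∀ u ∈ l.trans, u ∈ K) →
      sifts norm L g = true → g ∈ K
  | [], g, _, hg => by
    rw [of_decide_eq_true hg]
    exact K.one_mem
  | l :: L, g, h, hg => by
    simp only [sifts, List.any_eq_true, Bool.and_eq_true, hnorm] at hg
    obtain ⟨u, hu, _, hg⟩ := hg
    have h1 : u⁻¹ * g ∈ K :=
      mem_of_sifts hnorm (fun l' hl' => h l' (List.mem_cons_of_mem _ hl')) hg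
    simpa using K.mul_mem (h l List.mem_cons_self u hu) h1

/-- The generators of the group at the top of a chain. -/
def topGens : List (ChainLevel G X) → List G
  | [] => []
  | l :: _ => l.gens

/-- The group at the top of a chain, which is trivial for the empty chain. -/
def topGroup (L : List (ChainLevel G X)) : Subgroup G := Subgroup.closure {g | g ∈ topGens L}

theorem topGroup_nil : topGroup ([] : List (ChainLevel G X)) = ⊥ := by
  simp [topGroup, topGens]

/-- The requirements on a chain: at every level, the transversal contains `1` and no other element
that fixes the base point, the generators of the next group fix the base point, and the products of
a generator and an element of the transversal sift. -/
def checkChain [DecidableEq G] [SMul G X] [DecidableEq X] (norm : G → (G → Bool) → Bool) :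
    List (ChainLevel G X) → Bool
  | [] => true
  | l :: L =>
    ((l.trans.any fun u => decide (u = 1)) &&
      (l.trans.all fun u => !decide (u • l.base = l.base) || decide (u = 1))) &&
    (((topGens L).all fun s => decide (s • l.base = l.base)) &&
      (l.trans.all fun u => l.gens.all fun s => norm (s * u) (sifts norm (l :: L)))) &&
    checkChain norm L

theorem checkChain_cons [DecidableEq G] [SMul G X] [DecidableEq X] {norm : G → (G → Bool) → Bool}
    (hnorm : ∀ g k, norm g k = k g) {l : ChainLevel G X} {L : List (ChainLevel G X)}
    (h : checkChain norm (l :: L) = true) :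
    ((1 ∈ l.trans ∧ ∀ u ∈ l.trans, u • l.base = l.base → u = 1) ∧
      (∀ s ∈ topGens L, s • l.base = l.base) ∧
        ∀ u ∈ l.trans, ∀ s ∈ l.gens, sifts norm (l :: L) (s * u) = true) ∧
      checkChain norm L = true := by
  simpa only [checkChain, Bool.and_eq_true, List.any_eq_true, List.all_eq_true, Bool.or_eq_true,
    Bool.not_eq_true', decide_eq_true_eq, decide_eq_false_iff_not, exists_eq_right, hnorm,
    ← imp_iff_not_or] using h

theorem exists_inv_mul_mem_topGroup [Finite G] [DecidableEq G] [SMul G X] [DecidableEq X]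
    {norm : G → (G → Bool) → Bool} (hnorm : ∀ g k, norm g k = k g)
    {l : ChainLevel G X} {L : List (ChainLevel G X)} (hL : checkChain norm (l :: L) = true)
    (hmem : ∀ l' ∈ L, ∀ u ∈ l'.trans, u ∈ topGroup L) {g : G} (hg : g ∈ topGroup (l :: L)) :
    ∃ u ∈ l.trans, u⁻¹ * g ∈ topGroup L := by
  obtain ⟨⟨⟨h1, _⟩, _, hs⟩, _⟩ := checkChain_cons hnorm hL
  refine exists_inv_mul_mem_of_closure (T := {u | u ∈ l.trans}) h1 (fun s hs' u hu => ?_) hg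
  have h := hs u hu s hs'
  simp only [sifts, List.any_eq_true, Bool.and_eq_true, hnorm] at h
  obtain ⟨u', hu', _, h⟩ := h
  exact ⟨u', hu', mem_of_sifts hnorm hmem h⟩

theorem smul_of_mem_topGroup [MulAction G X] {x : X} {L : List (ChainLevel G X)}
    (h : ∀ s ∈ topGens L, s • x = x) {g : G} (hg : g ∈ topGroup L) : g • x = x := by
  have : topGroup L ≤ MulAction.stabilizer G x := (Subgroup.closure_le _).2 h
  exact this hg

/-- The transversals lie in the groups generated at their levels, and these groups decrease. -/
def IsNested : List (ChainLevel G X) → Prop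
  | [] => True
  | l :: L => (∀ u ∈ l.trans, u ∈ topGroup (l :: L)) ∧ topGroup L ≤ topGroup (l :: L) ∧ IsNested L

theorem IsNested.mem : ∀ {L : List (ChainLevel G X)}, IsNested L →
    ∀ l ∈ L, ∀ u ∈ l.trans, u ∈ topGroup L
  | [], _ => by simp
  | l :: L, ⟨h, hle, hL⟩ => fun l' hl' u hu => by
    rcases List.mem_cons.1 hl' with rfl | hl'
    · exact h u hu
    · exact hle (hL.mem l' hl' u hu)

theorem topGroup_le {L L' : List (ChainLevel G X)} (h : topGens L' ⊆ topGens L) :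
    topGroup L' ≤ topGroup L :=
  Subgroup.closure_mono fun _ hg => h hg

/-- In a chain which passes the check, every group contains the stabilizer of the base point in the
group above it. -/
theorem mem_topGroup_of_smul [Finite G] [DecidableEq G] [MulAction G X] [DecidableEq X]
    {norm : G → (G → Bool) → Bool} (hnorm : ∀ g k, norm g k = k g)
    {l : ChainLevel G X} {L : List (ChainLevel G X)} (hL : checkChain norm (l :: L) = true)
    (hN : IsNested L) {g : G} (hg : g ∈ topGroup (l :: L)) (hgb : g • l.base = l.base) :
    g ∈ topGroup L := by
  obtain ⟨⟨⟨_, htriv⟩, hfix, _⟩, _⟩ := checkChain_cons hnorm hL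
  obtain ⟨u, hu, hug⟩ := exists_inv_mul_mem_topGroup hnorm hL hN.mem hg
  have h := smul_of_mem_topGroup hfix hug
  rw [mul_smul, hgb, inv_smul_eq_iff] at h
  rw [htriv u hu h.symm] at hug
  simpa using hug

/-- The elements `1, g, …, g ^ (n - 1)`. -/
def powers (n : ℕ) (g : G) : List G := (List.range n).map (g ^ ·)

/-- The products of an element of the first list and an element of the second. -/
def products (T U : List G) : List G := T.flatMap fun u => U.map (u * ·)

theorem mem_of_mem_powers {K : Subgroup G} {n : ℕ} {g u : G} (hg : g ∈ K) (hu : u ∈ powers n g) :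
    u ∈ K := by
  obtain ⟨k, _, rfl⟩ := List.mem_map.1 hu
  exact K.pow_mem hg k

theorem mul_mem_products {T U : List G} {x y : G} (hx : x ∈ T) (hy : y ∈ U) :
    x * y ∈ products T U :=
  List.mem_flatMap.2 ⟨x, hx, List.mem_map.2 ⟨y, hy, rfl⟩⟩

theorem mem_of_mem_products {K : Subgroup G} {T U : List G} (hT : ∀ x ∈ T, x ∈ K)
    (hU : ∀ x ∈ U, x ∈ K) {u : G} (hu : u ∈ products T U) : u ∈ K := by
  obtain ⟨x, hx, hu⟩ := List.mem_flatMap.1 hu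
  obtain ⟨y, hy, rfl⟩ := List.mem_map.1 hu
  exact K.mul_mem (hT x hx) (hU y hy)

end Sifting

section Evaluation

variable {G X : Type*}

/-- Evaluation of a list of group elements, in continuation-passing style: provided that `norm`
evaluates its first argument before handing it over, so does `normList norm` with a list. -/
def normList (norm : G → (G → Bool) → Bool) : List G → (List G → Bool) → Bool
  | [], k => k []
  | u :: T, k => norm u fun u' => normList norm T fun T' => k (u' :: T')

theorem normList_eq {norm : G → (G → Bool) → Bool} (hnorm : ∀ g k, norm g k = k g) (T : List G)
    (k : List G → Bool) : normList norm T k = k T := by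
  induction T generalizing k with
  | nil => rfl
  | cons u T ih => rw [normList, hnorm, ih]

/-- Evaluation of the transversals of a chain, in continuation-passing style. -/
def normChain (norm : G → (G → Bool) → Bool) :
    List (ChainLevel G X) → (List (ChainLevel G X) → Bool) → Bool
  | [], k => k []
  | l :: L, k => normList norm l.trans fun T => normChain norm L fun L' =>
      k (⟨l.gens, l.base, T⟩ :: L')

theorem normChain_eq {norm : G → (G → Bool) → Bool} (hnorm : ∀ g k, norm g k = k g)
    (L : List (ChainLevel G X)) (k : List (ChainLevel G X) → Bool) :
    normChain norm L k = k L := by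
  induction L generalizing k with
  | nil => rfl
  | cons u T ih => rw [normChain, normList_eq hnorm, ih]

end Evaluation

/-! ### Permutations of twelve letters as numbers -/

/-- The value at `i` of the map whose one-line notation is the number `n` in base `16`. -/
def digit (n : ℕ) (i : Fin 12) : Fin 12 := Fin.ofNat 12 (n / 16 ^ (11 - (i : ℕ)) % 16)

/-- The permutation with one-line notation `f`, whose inverse has one-line notation `g`. -/
def tablePerm (f g : ℕ) (h : ∀ i, digit g (digit f i) = i) (h' : ∀ i, digit f (digit g i) = i) :
    Perm (Fin 12) :=
  ⟨digit f, digit g, h, h'⟩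

/-- The one-line notation of a permutation, as a number in base `16`. -/
def code (σ : Perm (Fin 12)) : ℕ := (List.finRange 12).foldl (fun n i => 16 * n + (σ i : ℕ)) 0

set_option linter.unusedSimpArgs false in
theorem digit_code (σ : Perm (Fin 12)) (i : Fin 12) : digit (code σ) i = σ i := by
  have h : ∀ i, (σ i : ℕ) < 12 := fun i => (σ i).2
  have hc : code σ = (List.finRange 12).foldl (fun n i => 16 * n + (σ i : ℕ)) 0 := rfl
  rw [show List.finRange 12 = [0, 1, 2, 3, 4, 5, 6, 7, 8, 9, 10, 11] from rfl] at hc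
  simp only [List.foldl_cons, List.foldl_nil] at hc
  have h0 := h 0; have h1 := h 1; have h2 := h 2; have h3 := h 3; have h4 := h 4; have h5 := h 5
  have h6 := h 6; have h7 := h 7; have h8 := h 8; have h9 := h 9; have h10 := h 10
  have h11 := h 11
  apply Fin.ext
  simp only [digit, Fin.ofNat, hc]
  fin_cases i <;>
    simp only [Fin.zero_eta, Fin.mk_one, Fin.reduceFinMk, Fin.isValue, Fin.val_zero,
      Fin.val_one, Nat.reduceSub, Nat.reducePow] <;> omega

/-- Evaluation of a natural number before it is handed to `k`: a recursion on `n` has to reduce `n`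
to a literal. -/
def force (n : ℕ) (k : (m : ℕ) → m = n → Bool) : Bool :=
  Nat.rec (motive := fun m => m = n → Bool) (k 0) (fun m _ => k (m + 1)) n rfl

theorem force_eq (n : ℕ) (k : (m : ℕ) → m = n → Bool) : force n k = k n rfl := by
  have : ∀ m (h : m = n), Nat.rec (motive := fun m => m = n → Bool) (k 0)
      (fun m _ => k (m + 1)) m h = k m h := fun m h => by cases m <;> rfl
  exact this n rfl

/-- A pair of permutations of twelve letters. -/
abbrev PermPair : Type := Perm (Fin 12) × Perm (Fin 12)

/-- Evaluation of a permutation before it is handed to `k`. -/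
def normPerm (σ : Perm (Fin 12)) (k : Perm (Fin 12) → Bool) : Bool :=
  force (code σ) fun n hn => force (code σ⁻¹) fun m hm =>
    k (tablePerm n m (fun i => by subst hn hm; simp [digit_code])
      (fun i => by subst hn hm; simp [digit_code]))

theorem normPerm_eq (σ : Perm (Fin 12)) (k : Perm (Fin 12) → Bool) : normPerm σ k = k σ := by
  rw [normPerm, force_eq, force_eq]
  congr 1
  ext i
  simp [tablePerm, digit_code]

/-- Evaluation of a pair of permutations before it is handed to `k`. -/
def normPair (p : PermPair) (k : PermPair → Bool) : Bool :=
  normPerm p.1 fun x => normPerm p.2 fun y => k (x, y)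

theorem normPair_eq (p : PermPair) (k : PermPair → Bool) : normPair p k = k p := by
  simp [normPair, normPerm_eq]

/-- A pair of permutations acts on the letters `e` by its first entry and on the letters `ē` by its
second entry. -/
instance : MulAction PermPair (Fin 12 ⊕ Fin 12) :=
  MulAction.compHom _ (Perm.sumCongrHom (Fin 12) (Fin 12))

/-! ### The Mathieu group and its twin action -/

/-- `M₁₂`, acting on the letters `e` in the given way and on the letters `ē` in its twin way. -/
def M12Pair : Subgroup PermPair := Subgroup.closure {(gen0, gen0⁻¹), (gen1, gen1⁻¹)}

namespace M12Pair

/-- `γ₀`, with its twin. -/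
def a : PermPair :=
  (tablePerm 0xa231564897b0 0xb3126459780a (by decide +kernel) (by decide +kernel),
    tablePerm 0xb3126459780a 0xa231564897b0 (by decide +kernel) (by decide +kernel))

/-- `γ₁`, with its twin. -/
def b : PermPair :=
  (tablePerm 0xb1243765a980 0xb1243765a980 (by decide +kernel) (by decide +kernel),
    tablePerm 0xb1243765a980 0xb1243765a980 (by decide +kernel) (by decide +kernel))

/-- `γ₀γ₁`, an element of order `11`. -/
def x : PermPair :=
  (tablePerm 0x02351846b79a 0x041263795ab8 (by decide +kernel) (by decide +kernel),
    tablePerm 0xa3162954087b 0x8241763a950b (by decide +kernel) (by decide +kernel))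

/-- `γ₀⁻¹γ₁`, an element of order `11`. -/
def y : PermPair :=
  (tablePerm 0xa3162954087b 0x8241763a950b (by decide +kernel) (by decide +kernel),
    tablePerm 0x02351846b79a 0x041263795ab8 (by decide +kernel) (by decide +kernel))

/-- An element of order `11` which fixes the letter `12` and its twin. -/
def z : PermPair :=
  (tablePerm 0x0241593b678a 0x03162489a5b7 (by decide +kernel) (by decide +kernel),
    tablePerm 0x03162489a5b7 0x0241593b678a (by decide +kernel) (by decide +kernel))

/-- An element of order `5` which fixes the letters `12`, `3` and the twin of `12`. -/
def w : PermPair :=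
  (tablePerm 0x08a36b927514 0x0a73b9481625 (by decide +kernel) (by decide +kernel),
    tablePerm 0x0a73b9481625 0x08a36b927514 (by decide +kernel) (by decide +kernel))

/-- An involution which fixes the letters `12`, `3` and the twin of `12`. -/
def u : PermPair :=
  (tablePerm 0x08432a69175b 0x08432a69175b (by decide +kernel) (by decide +kernel),
    tablePerm 0x021ab9678534 0x021ab9678534 (by decide +kernel) (by decide +kernel))

/-- An element of order `3` which fixes the letters `12`, `3`, `7` and the twin of `12`. -/
def v : PermPair :=
  (tablePerm 0x06831947ba52 0x04b36a172598 (by decide +kernel) (by decide +kernel),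
    tablePerm 0x08729563ab14 0x0a37b5621489 (by decide +kernel) (by decide +kernel))

/-- An involution which fixes the letters `12`, `3`, `7` and the twin of `12`. -/
def r : PermPair :=
  (tablePerm 0x0923a657b148 0x0923a657b148 (by decide +kernel) (by decide +kernel),
    tablePerm 0x0a279653841b 0x0a279653841b (by decide +kernel) (by decide +kernel))

/-- An element of order `3` which commutes with `v` and fixes the letters `12`, `3`, `7`. -/
def v' : PermPair :=
  (tablePerm 0x09135ba76284 0x0293b487a165 (by decide +kernel) (by decide +kernel),
    tablePerm 0x613790528ba4 0x5172b60384a9 (by decide +kernel) (by decide +kernel))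

/-- An element of order `4` which fixes the letters `12`, `3`, `7`, `8`. -/
def q : PermPair :=
  (tablePerm 0x0a43b6178259 0x06932a578b14 (by decide +kernel) (by decide +kernel),
    tablePerm 0x7965a230b841 0x7b56a3209148 (by decide +kernel) (by decide +kernel))

/-- An element of order `4` which generates with `q` a quaternion group fixing the letters `12`,
`3`, `7`, `8`. -/
def q' : PermPair :=
  (tablePerm 0x0253ab478691 0x0b1362978a45 (by decide +kernel) (by decide +kernel),
    tablePerm 0x431809ba2675 0x42810b9a3576 (by decide +kernel) (by decide +kernel))

theorem a_eq : a = (gen0, gen0⁻¹) := by decide +kernel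
theorem b_eq : b = (gen1, gen1⁻¹) := by decide +kernel
theorem x_eq : x = a * b := by decide +kernel
theorem y_eq : y = a⁻¹ * b := by decide +kernel
theorem z_eq : z = b * x * y * x * y * x := by decide +kernel
theorem w_eq : w = x * y * x * x * y * y * y * x * x * y * a := by decide +kernel
theorem u_eq : u = y * x * x * x * x * y * y * y * y * a := by decide +kernel
theorem v_eq : v = y * x * y * x * x * x * y * x * x * x := by decide +kernel
theorem r_eq : r = x * y * x * x * x * y * y * y * x * a⁻¹ := by decide +kernel
theorem v'_eq : v' = y * x * y * y * y * x * y * y * y * x := by decide +kernel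

theorem closure_eq : M12Pair = Subgroup.closure {a, b} := by rw [M12Pair, a_eq, b_eq]

theorem a_mem : a ∈ M12Pair := closure_eq ▸ Subgroup.subset_closure (by simp)
theorem b_mem : b ∈ M12Pair := closure_eq ▸ Subgroup.subset_closure (by simp)
theorem x_mem : x ∈ M12Pair := x_eq ▸ mul_mem a_mem b_mem
theorem y_mem : y ∈ M12Pair := y_eq ▸ mul_mem (inv_mem a_mem) b_mem

theorem z_mem : z ∈ M12Pair := by
  rw [z_eq]; repeat' first | exact b_mem | exact x_mem | exact y_mem | apply mul_mem
theorem w_mem : w ∈ M12Pair := by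
  rw [w_eq]; repeat' first | exact a_mem | exact x_mem | exact y_mem | apply mul_mem
theorem u_mem : u ∈ M12Pair := by
  rw [u_eq]; repeat' first | exact a_mem | exact x_mem | exact y_mem | apply mul_mem
theorem v_mem : v ∈ M12Pair := by
  rw [v_eq]; repeat' first | exact x_mem | exact y_mem | apply mul_mem
theorem r_mem : r ∈ M12Pair := by
  rw [r_eq]; repeat' first | exact inv_mem a_mem | exact x_mem | exact y_mem | apply mul_mem
theorem v'_mem : v' ∈ M12Pair := by
  rw [v'_eq]; repeat' first | exact x_mem | exact y_mem | apply mul_mem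

/-- A transversal of the stabilizer of the letter `12`. -/
def T1 : List PermPair := 1 :: products (powers 11 z) [a]
/-- Elements fixing the letter `12` and carrying its twin to all the letters `ē`. -/
def T2 : List PermPair := 1 :: products (powers 11 z) [x]
/-- Elements fixing the letter `12` and its twin, and carrying the letter `3` to all the others. -/
def T3 : List PermPair := powers 11 z
/-- Elements fixing the letters `12`, `3` and the twin of `12`, and carrying the letter `7` to all
the others. -/
def T4 : List PermPair := products (powers 5 w) (powers 2 u)
/-- The elements fixing the letters `12`, `3`, `7` and the twin of `12`. -/
def T5 : List PermPair := products (powers 3 v) (powers 2 r)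
/-- Elements fixing the letters `12`, `3`, `7`, and carrying the letter `8` to all the others. -/
def U5 : List PermPair := products (powers 3 v) (powers 3 v')
/-- The elements fixing the letters `12`, `3`, `7`, `8`, which form a quaternion group. -/
def U6 : List PermPair := products (powers 4 q) (powers 2 q')

/-- The levels of stabilizer chains for base points among the letters `e`, `ē`. -/
abbrev Level : Type := ChainLevel PermPair (Fin 12 ⊕ Fin 12)

/-- The stabilizer of the letters `12`, `3`, `7` and the twin of `12`, which acts regularly on the
orbit of the letter `1`. -/
def twinChain5 : List Level := [⟨[v, r], .inl 1, T5⟩]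
/-- A chain for the stabilizer of the letters `12`, `3` and the twin of `12`. -/
def twinChain4 : List Level := ⟨[w, u, v, r], .inl 7, T4⟩ :: twinChain5
/-- A chain for the stabilizer of the letter `12` and its twin. -/
def twinChain3 : List Level := ⟨[z, w, u, v, r], .inl 3, T3⟩ :: twinChain4
/-- A chain for the stabilizer of the letter `12`. -/
def twinChain2 : List Level := ⟨[x, z, w, u, v, r], .inr 0, T2⟩ :: twinChain3
/-- A chain for `M₁₂` that passes through the stabilizer of the letter `12` and its twin. -/
def twinChain : List Level := ⟨[a, b], .inl 0, T1⟩ :: twinChain2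

/-- The stabilizer of the letters `12`, `3`, `7`, `8`, which acts regularly on the remaining
letters. -/
def letterChain5 : List Level := [⟨[q, q'], .inl 1, U6⟩]
/-- A chain for the stabilizer of the letters `12`, `3`, `7`. -/
def letterChain4 : List Level := ⟨[v, v', q, q'], .inl 8, U5⟩ :: letterChain5
/-- A chain for the stabilizer of the letters `12`, `3`. -/
def letterChain3 : List Level := ⟨[w, u, v, v', q, q'], .inl 7, T4⟩ :: letterChain4
/-- A chain for the stabilizer of the letter `12`, with base points among the letters `e` only. -/
def letterChain2 : List Level := ⟨[z, w, u, v, v', q, q'], .inl 3, T3⟩ :: letterChain3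
/-- A chain for `M₁₂` with base points among the letters `e` only. -/
def letterChain : List Level := ⟨[a, b], .inl 0, T1⟩ :: letterChain2

theorem checkChain_twinChain : checkChain normPair twinChain = true := by
  have : normChain normPair twinChain (checkChain normPair) = true := by decide +kernel
  rwa [normChain_eq normPair_eq] at this

theorem checkChain_letterChain : checkChain normPair letterChain = true := by
  have : normChain normPair letterChain (checkChain normPair) = true := by decide +kernel
  rwa [normChain_eq normPair_eq] at this

theorem checkChain_tail {l : Level} {L : List Level} (h : checkChain normPair (l :: L) = true) :
    checkChain normPair L = true :=
  (checkChain_cons normPair_eq h).2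

end M12Pair

/-! ### Transitivity and involutions of the Mathieu group -/

namespace M12Pair

theorem mem_topGroup_of_mem {L : List Level} {g : PermPair} (hg : g ∈ topGens L) :
    g ∈ topGroup L :=
  Subgroup.subset_closure hg

theorem isNested_twinChain5 : IsNested twinChain5 :=
  ⟨fun _ => mem_of_mem_products
    (fun _ => mem_of_mem_powers (mem_topGroup_of_mem (by simp [topGens])))
    (fun _ => mem_of_mem_powers (mem_topGroup_of_mem (by simp [topGens]))),
    by rw [topGroup_nil]; exact bot_le, trivial⟩

theorem isNested_twinChain4 : IsNested twinChain4 :=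
  ⟨fun _ => mem_of_mem_products
    (fun _ => mem_of_mem_powers (mem_topGroup_of_mem (by simp [topGens])))
    (fun _ => mem_of_mem_powers (mem_topGroup_of_mem (by simp [topGens]))),
    topGroup_le (by simp [topGens, twinChain5]), isNested_twinChain5⟩

theorem isNested_twinChain3 : IsNested twinChain3 :=
  ⟨fun _ => mem_of_mem_powers (mem_topGroup_of_mem (by simp [topGens])),
    topGroup_le (by simp [topGens, twinChain4]), isNested_twinChain4⟩

theorem isNested_twinChain2 : IsNested twinChain2 := by
  refine ⟨fun g hg => ?_, topGroup_le (by simp [topGens, twinChain3]), isNested_twinChain3⟩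
  rcases List.mem_cons.1 hg with rfl | hg
  · exact one_mem _
  · refine mem_of_mem_products (fun _ => mem_of_mem_powers ?_) (fun _ h => ?_) hg
    · exact mem_topGroup_of_mem (by simp [topGens])
    · rw [List.mem_singleton.1 h]
      exact mem_topGroup_of_mem (by simp [topGens])

theorem isNested_letterChain5 : IsNested letterChain5 :=
  ⟨fun _ => mem_of_mem_products
    (fun _ => mem_of_mem_powers (mem_topGroup_of_mem (by simp [topGens])))
    (fun _ => mem_of_mem_powers (mem_topGroup_of_mem (by simp [topGens]))),
    by rw [topGroup_nil]; exact bot_le, trivial⟩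

theorem isNested_letterChain4 : IsNested letterChain4 :=
  ⟨fun _ => mem_of_mem_products
    (fun _ => mem_of_mem_powers (mem_topGroup_of_mem (by simp [topGens])))
    (fun _ => mem_of_mem_powers (mem_topGroup_of_mem (by simp [topGens]))),
    topGroup_le (by simp [topGens, letterChain5]), isNested_letterChain5⟩

theorem isNested_letterChain3 : IsNested letterChain3 :=
  ⟨fun _ => mem_of_mem_products
    (fun _ => mem_of_mem_powers (mem_topGroup_of_mem (by simp [topGens])))
    (fun _ => mem_of_mem_powers (mem_topGroup_of_mem (by simp [topGens]))),
    topGroup_le (by simp [topGens, letterChain4]), isNested_letterChain4⟩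

theorem isNested_letterChain2 : IsNested letterChain2 :=
  ⟨fun _ => mem_of_mem_powers (mem_topGroup_of_mem (by simp [topGens])),
    topGroup_le (by simp [topGens, letterChain3]), isNested_letterChain3⟩

theorem topGroup_eq {L : List Level} (hL : topGens L = [a, b]) : topGroup L = M12Pair := by
  rw [topGroup, hL, closure_eq]
  simp [Set.insert_def]

theorem T1_subset {g : PermPair} (hg : g ∈ T1) : g ∈ M12Pair := by
  rcases List.mem_cons.1 hg with rfl | hg
  · exact one_mem _
  · refine mem_of_mem_products (fun _ => mem_of_mem_powers z_mem) (fun _ h => ?_) hg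
    rw [List.mem_singleton.1 h]
    exact a_mem

theorem T2_subset {g : PermPair} (hg : g ∈ T2) : g ∈ M12Pair := by
  rcases List.mem_cons.1 hg with rfl | hg
  · exact one_mem _
  · refine mem_of_mem_products (fun _ => mem_of_mem_powers z_mem) (fun _ h => ?_) hg
    rw [List.mem_singleton.1 h]
    exact x_mem

theorem T3_subset {g : PermPair} (hg : g ∈ T3) : g ∈ M12Pair := mem_of_mem_powers z_mem hg

theorem T4_subset {g : PermPair} (hg : g ∈ T4) : g ∈ M12Pair :=
  mem_of_mem_products (fun _ => mem_of_mem_powers w_mem) (fun _ => mem_of_mem_powers u_mem) hg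

theorem T5_subset {g : PermPair} (hg : g ∈ T5) : g ∈ M12Pair :=
  mem_of_mem_products (fun _ => mem_of_mem_powers v_mem) (fun _ => mem_of_mem_powers r_mem) hg

theorem U5_subset {g : PermPair} (hg : g ∈ U5) : g ∈ M12Pair :=
  mem_of_mem_products (fun _ => mem_of_mem_powers v_mem) (fun _ => mem_of_mem_powers v'_mem) hg

/-- `M₁₂` acts transitively on the pairs of a letter `e` and a letter `ē`. -/
theorem exists_twin (i j : Fin 12) : ∃ g ∈ M12Pair, g.1 0 = i ∧ g.2 0 = j := by
  have h1 : ∀ i, ∃ u ∈ T1, u.1 0 = i := by decide +kernel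
  have h2 : ∀ j, ∃ u ∈ T2, u.1 0 = 0 ∧ u.2 0 = j := by decide +kernel
  obtain ⟨u, hu, hui⟩ := h1 i
  obtain ⟨t, ht, ht0, htj⟩ := h2 (u.2⁻¹ j)
  refine ⟨u * t, mul_mem (T1_subset hu) (T2_subset ht), ?_, ?_⟩
  · simp [ht0, hui]
  · simp [htj]

/-- `M₁₂` acts four-fold transitively on the letters. -/
theorem exists_letters {i j k l : Fin 12} (hij : i ≠ j) (hik : i ≠ k) (hil : i ≠ l) (hjk : j ≠ k)
    (hjl : j ≠ l) (hkl : k ≠ l) :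
    ∃ g ∈ M12Pair, g.1 0 = i ∧ g.1 3 = j ∧ g.1 7 = k ∧ g.1 8 = l := by
  have h1 : ∀ i, ∃ u ∈ T1, u.1 0 = i := by decide +kernel
  have h2 : ∀ j ≠ 0, ∃ u ∈ T3, u.1 0 = 0 ∧ u.1 3 = j := by decide +kernel
  have h3 : ∀ k, k ≠ 0 → k ≠ 3 → ∃ u ∈ T4, u.1 0 = 0 ∧ u.1 3 = 3 ∧ u.1 7 = k := by decide +kernel
  have h4 : ∀ l, l ≠ 0 → l ≠ 3 → l ≠ 7 →
      ∃ u ∈ U5, u.1 0 = 0 ∧ u.1 3 = 3 ∧ u.1 7 = 7 ∧ u.1 8 = l := by decide +kernel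
  obtain ⟨u, hu, rfl⟩ := h1 i
  obtain ⟨s, hs, hs0, hsj⟩ := h2 (u.1⁻¹ j) (by
    rw [Ne, Perm.inv_eq_iff_eq]; exact hij.symm)
  obtain rfl : j = u.1 (s.1 3) := by rw [hsj]; simp
  obtain ⟨t, ht, ht0, ht3, htk⟩ := h3 (s.1⁻¹ (u.1⁻¹ k))
    (by rw [Ne, Perm.inv_eq_iff_eq, Perm.inv_eq_iff_eq, hs0]; exact hik.symm)
    (by rw [Ne, Perm.inv_eq_iff_eq, Perm.inv_eq_iff_eq]; exact hjk.symm)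
  obtain rfl : k = u.1 (s.1 (t.1 7)) := by rw [htk]; simp
  obtain ⟨n, hn, hn0, hn3, hn7, hnl⟩ := h4 (t.1⁻¹ (s.1⁻¹ (u.1⁻¹ l)))
    (by rw [Ne, Perm.inv_eq_iff_eq, Perm.inv_eq_iff_eq, Perm.inv_eq_iff_eq, ht0, hs0]
        exact hil.symm)
    (by rw [Ne, Perm.inv_eq_iff_eq, Perm.inv_eq_iff_eq, Perm.inv_eq_iff_eq, ht3]
        exact hjl.symm)
    (by rw [Ne, Perm.inv_eq_iff_eq, Perm.inv_eq_iff_eq, Perm.inv_eq_iff_eq]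
        exact hkl.symm)
  refine ⟨u * s * t * n, mul_mem (mul_mem (mul_mem (T1_subset hu) (T3_subset hs)) (T4_subset ht))
    (U5_subset hn), ?_, ?_, ?_, ?_⟩
  · simp [hn0, ht0, hs0]
  · simp [hn3, ht3]
  · simp [hn7]
  · simp [hnl]

/-- The elements of `M₁₂` that fix the letter `12` and its twin; they form a group `L₂(11)`. -/
def L211 : List PermPair := products T3 (products T4 T5)

theorem L211_subset {g : PermPair} (hg : g ∈ L211) : g ∈ M12Pair :=
  mem_of_mem_products (fun _ => T3_subset)
    (fun _ => mem_of_mem_products (fun _ => T4_subset) (fun _ => T5_subset)) hg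

theorem mem_L211 {g : PermPair} (hg : g ∈ M12Pair) (h1 : g.1 0 = 0) (h2 : g.2 0 = 0) :
    g ∈ L211 := by
  have hC2 : checkChain normPair twinChain2 = true := checkChain_tail checkChain_twinChain
  have hC3 : checkChain normPair twinChain3 = true := checkChain_tail hC2
  have hC4 : checkChain normPair twinChain4 = true := checkChain_tail hC3
  have hg1 : g ∈ topGroup twinChain := by rwa [topGroup_eq rfl]
  have hg2 : g ∈ topGroup twinChain2 := mem_topGroup_of_smul normPair_eq checkChain_twinChain
    isNested_twinChain2 hg1 (congrArg Sum.inl h1)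
  have hg3 : g ∈ topGroup twinChain3 := mem_topGroup_of_smul normPair_eq hC2
    isNested_twinChain3 hg2 (congrArg Sum.inr h2)
  obtain ⟨s, hs, hg4⟩ := exists_inv_mul_mem_topGroup normPair_eq hC3 isNested_twinChain4.mem hg3
  obtain ⟨t, ht, hg5⟩ := exists_inv_mul_mem_topGroup normPair_eq hC4 isNested_twinChain5.mem hg4
  obtain ⟨n, hn, hg6⟩ := exists_inv_mul_mem_topGroup (L := []) normPair_eq
    (checkChain_tail hC4) (by simp) hg5
  rw [topGroup_nil, Subgroup.mem_bot, inv_mul_eq_one, eq_inv_mul_iff_mul_eq,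
    eq_inv_mul_iff_mul_eq] at hg6
  rw [← hg6]
  exact mul_mem_products hs (mul_mem_products ht hn)

theorem mem_U6 {g : PermPair} (hg : g ∈ M12Pair) (h0 : g.1 0 = 0) (h3 : g.1 3 = 3)
    (h7 : g.1 7 = 7) (h8 : g.1 8 = 8) : g ∈ U6 := by
  have hC2 : checkChain normPair letterChain2 = true := checkChain_tail checkChain_letterChain
  have hC3 : checkChain normPair letterChain3 = true := checkChain_tail hC2
  have hC4 : checkChain normPair letterChain4 = true := checkChain_tail hC3
  have hg1 : g ∈ topGroup letterChain := by rwa [topGroup_eq rfl]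
  have hg2 : g ∈ topGroup letterChain2 := mem_topGroup_of_smul normPair_eq checkChain_letterChain
    isNested_letterChain2 hg1 (congrArg Sum.inl h0)
  have hg3 : g ∈ topGroup letterChain3 := mem_topGroup_of_smul normPair_eq hC2
    isNested_letterChain3 hg2 (congrArg Sum.inl h3)
  have hg4 : g ∈ topGroup letterChain4 := mem_topGroup_of_smul normPair_eq hC3
    isNested_letterChain4 hg3 (congrArg Sum.inl h7)
  have hg5 : g ∈ topGroup letterChain5 := mem_topGroup_of_smul normPair_eq hC4
    isNested_letterChain5 hg4 (congrArg Sum.inl h8)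
  obtain ⟨n, hn, hg6⟩ := exists_inv_mul_mem_topGroup (L := []) normPair_eq
    (checkChain_tail hC4) (by simp) hg5
  rw [topGroup_nil, Subgroup.mem_bot, inv_mul_eq_one] at hg6
  rw [← hg6]
  exact hn

theorem exists_twisted_conj_of_mem_L211 {g : PermPair} (hg : g ∈ L211) (h : g.1 * g.2 = 1) :
    ∃ h ∈ L211, h.1 = g.1 * h.2 := by
  have key : normList normPair L211 (fun L => L.all fun g => !decide (g.1 * g.2 = 1) ||
      L.any fun h => decide (h.1 = g.1 * h.2)) = true := by decide +kernel
  rw [normList_eq normPair_eq] at key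
  simpa [h] using List.all_eq_true.1 key g hg

theorem swap_mem {g : PermPair} (hg : g ∈ M12Pair) : g.swap ∈ M12Pair := by
  induction hg using Subgroup.closure_induction with
  | mem g hg =>
    rcases hg with rfl | rfl
    · have := inv_mem a_mem
      rw [a_eq] at this
      simpa using this
    · have := inv_mem b_mem
      rw [b_eq] at this
      simpa using this
  | one => exact one_mem _
  | mul g h _ _ hg hh => exact mul_mem hg hh
  | inv g _ hg => exact inv_mem hg

/-- If the twinning automorphism maps `x` to its inverse, then `x` is the quotient of an element and
its twin. -/
theorem exists_twisted_conj {g : PermPair} (hg : g ∈ M12Pair) (h : g.1 * g.2 = 1) :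
    ∃ h ∈ M12Pair, h.1 = g.1 * h.2 := by
  -- after conjugation, `x` fixes the letter `12`
  obtain ⟨k, hk, hk1, hk2⟩ := exists_twin (g.1 0) 0
  have hg2 : g.2 = g.1⁻¹ := eq_inv_of_mul_eq_one_right h
  have h0 : (k⁻¹ * g * k.swap).1 0 = 0 := by
    simp [hk2, ← hk1]
  have h1 : (k⁻¹ * g * k.swap).1 * (k⁻¹ * g * k.swap).2 = 1 := by
    simp [hg2, mul_assoc]
  have h2 : (k⁻¹ * g * k.swap).2 0 = 0 := by
    rw [eq_inv_of_mul_eq_one_right h1, Perm.inv_eq_iff_eq, h0]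
  obtain ⟨n, hn, hn1⟩ := exists_twisted_conj_of_mem_L211
    (mem_L211 (mul_mem (mul_mem (inv_mem hk) hg) (swap_mem hk)) h0 h2) h1
  refine ⟨k * n, mul_mem hk (L211_subset hn), ?_⟩
  simp [hn1, mul_assoc]

theorem exists_of_mem_M12 {g : Perm (Fin 12)} (hg : g ∈ M12) : ∃ p ∈ M12Pair, p.1 = g := by
  have : M12 = M12Pair.map (MonoidHom.fst _ _) := by
    simp [M12, M12Pair, MonoidHom.map_closure, Set.image_pair]
  rw [this] at hg
  exact hg

theorem fst_mem {p : PermPair} (hp : p ∈ M12Pair) : p.1 ∈ M12 := by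
  have : M12 = M12Pair.map (MonoidHom.fst _ _) := by
    simp [M12, M12Pair, MonoidHom.map_closure, Set.image_pair]
  rw [this]
  exact ⟨p, hp, rfl⟩

theorem sign_of_mem_M12 {g : Perm (Fin 12)} (hg : g ∈ M12) : Perm.sign g = 1 := by
  have : M12 ≤ (Perm.sign : Perm (Fin 12) →* ℤˣ).ker := by
    refine (Subgroup.closure_le _).2 ?_
    rintro _ (rfl | rfl)
    · simp only [SetLike.mem_coe, MonoidHom.mem_ker]
      decide +kernel
    · simp only [SetLike.mem_coe, MonoidHom.mem_ker]
      decide +kernel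
  exact this hg

/-- An element of `M₁₂` which interchanges the letters `12` and `3`, and `7` and `8`. -/
def s : PermPair := x * x * y * x * x * x * y * x * y * y * y * x * y * a⁻¹

theorem s_mem : s ∈ M12Pair := by
  unfold s
  repeat' first | exact inv_mem a_mem | exact x_mem | exact y_mem | apply mul_mem

/-- Elements conjugating `rep2A` and `gen1` to all the involutions of `M₁₂` which interchange `12`
and `3`, and `7` and `8`. -/
def conjugators : List PermPair :=
  [x * x * y * x * x * x * a⁻¹, b * x * x * x * y * x * x * a⁻¹, x * x * y * y * y * x * a⁻¹,
    y * y * y * y * a, b * y * x * x * x * y * x * a⁻¹, x * x * x * y * x * x * x * a⁻¹]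

theorem conjugators_subset {g : PermPair} (hg : g ∈ conjugators) : g ∈ M12Pair := by
  simp only [conjugators, List.mem_cons, List.not_mem_nil, or_false] at hg
  rcases hg with rfl | rfl | rfl | rfl | rfl | rfl <;>
  repeat' first | exact a_mem | exact b_mem | exact inv_mem a_mem | exact x_mem | exact y_mem |
    apply mul_mem

theorem involution_of_mem_U6 {g : PermPair} (hg : g ∈ U6) (h : (s * g).1 * (s * g).1 = 1) :
    ∃ h ∈ conjugators, h.1 * rep2A = (s * g).1 * h.1 ∨ h.1 * gen1 = (s * g).1 * h.1 := by
  have key : (normPerm rep2A fun r2 => normPerm gen1 fun g1 =>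
      normList normPair conjugators fun L =>
      normPair s fun s => U6.all fun g => normPair (s * g) fun g => !decide (g.1 * g.1 = 1) ||
      L.any fun h => decide (h.1 * r2 = g.1 * h.1) || decide (h.1 * g1 = g.1 * h.1)) = true := by
    decide +kernel
  simp only [normPerm_eq, normPair_eq, normList_eq normPair_eq, List.all_eq_true] at key
  have := key g hg
  simp only [h, decide_true, Bool.not_true, Bool.false_or, List.any_eq_true, Bool.or_eq_true,
    decide_eq_true_eq] at this
  exact this

end M12Pair

open M12Pair in
/-- The involutions of `M₁₂` form the class `2A` and the class of `gen1`. -/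
theorem involution_of_mem_M12 {g : Perm (Fin 12)} (hg : g ∈ M12) (h : g * g = 1) (h1 : g ≠ 1) :
    g ∈ class2A ∨ ∃ h ∈ M12, h * gen1 * h⁻¹ = g := by
  have hgg : ∀ i, g (g i) = i := fun i => by rw [← Perm.mul_apply, h, Perm.one_apply]
  obtain ⟨i, hi⟩ : ∃ i, g i ≠ i := by
    by_contra! h'
    exact h1 (Equiv.ext h')
  -- an involution which moves only two letters would be a transposition, an odd permutation
  obtain ⟨k, hki, hkg, hk⟩ : ∃ k, k ≠ i ∧ k ≠ g i ∧ g k ≠ k := by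
    by_contra! h'
    have : g = Equiv.swap i (g i) := by
      ext1 k
      by_cases hki : k = i
      · simp [hki]
      by_cases hkg : k = g i
      · simp [hkg, hgg]
      rw [h' k hki hkg, Equiv.swap_apply_of_ne_of_ne hki hkg]
    have h2 := sign_of_mem_M12 hg
    rw [this, Perm.sign_swap hi.symm] at h2
    exact absurd h2 (by decide)
  have hgk : g k ≠ i := fun h' => hkg (by rw [← h', hgg])
  obtain ⟨n, hn, hn0, hn3, hn7, hn8⟩ := exists_letters hi.symm hki.symm hgk.symm hkg.symm
    (g.injective.ne hki.symm) hk.symm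
  obtain ⟨p, hp, hpg⟩ := exists_of_mem_M12 hg
  -- conjugation by `n` makes `g` interchange the four letters like `s`
  have key : s⁻¹ * (n⁻¹ * p * n) ∈ U6 := by
    have hs : s.1 0 = 3 ∧ s.1 3 = 0 ∧ s.1 7 = 8 ∧ s.1 8 = 7 := by decide +kernel
    refine mem_U6 (mul_mem (inv_mem s_mem) (mul_mem (mul_mem (inv_mem hn) hp) hn)) ?_ ?_ ?_ ?_ <;>
    simp [hpg, hn0, hn3, hn7, hn8, Equiv.symm_apply_eq, hs, hgg]
  have hsq : (s * (s⁻¹ * (n⁻¹ * p * n))).1 * (s * (s⁻¹ * (n⁻¹ * p * n))).1 = 1 := by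
    simp only [mul_inv_cancel_left, Prod.fst_mul, Prod.fst_inv, hpg]
    calc _ = n.1⁻¹ * (g * g) * n.1 := by group
      _ = 1 := by rw [h]; group
  obtain ⟨m, hm, hmg⟩ := involution_of_mem_U6 key hsq
  have hm' := fst_mem (conjugators_subset hm)
  simp only [mul_inv_cancel_left, Prod.fst_mul, Prod.fst_inv, hpg] at hmg
  refine hmg.imp (fun h => ⟨n.1 * m.1, mul_mem (fst_mem hn) hm', ?_⟩)
    (fun h => ⟨n.1 * m.1, mul_mem (fst_mem hn) hm', ?_⟩)
  · calc _ = n.1 * (m.1 * rep2A) * m.1⁻¹ * n.1⁻¹ := by group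
      _ = g := by rw [h]; group
  · calc _ = n.1 * (m.1 * gen1) * m.1⁻¹ * n.1⁻¹ := by group
      _ = g := by rw [h]; group

/-! ### The Hadamard matrix of order twelve -/

/-- The rows of `hadamard`; the binary digits `1` and `0` stand for the entries `1` and `-1`. -/
def hadamardRows : Fin 12 → ℕ :=
  ![0b110010100111, 0b100110000000, 0b001000100001, 0b010001000010, 0b110000011001, 0b000100010111,
    0b101000001110, 0b000011001101, 0b000010111010, 0b100001110100, 0b100101101011, 0b101011010011]

/-- A symmetric Hadamard matrix of order `12`. -/
def hadamard (i j : Fin 12) : ℤˣ := if (hadamardRows i).testBit (11 - j) then 1 else -1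

theorem hadamard_symm (i j : Fin 12) : hadamard i j = hadamard j i := by
  have : ∀ i j, hadamard i j = hadamard j i := by decide +kernel
  exact this i j

theorem three_dvd_sum_hadamard (j k : Fin 12) :
    (3 : ℤ) ∣ ∑ i, (hadamard i j : ℤ) * hadamard i k := by
  have : ∀ j k : Fin 12, (∑ i, (hadamard i j : ℤ) * hadamard i k) % 3 = 0 := by decide +kernel
  exact Int.dvd_of_emod_eq_zero (this j k)

/-- The form defined by `hadamard` on signed letters. -/
def hadamardForm (p q : SignedLetter) : ℤˣ := p.2 * hadamard p.1 q.1 * q.2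

theorem hadamardForm_symm (p q : SignedLetter) : hadamardForm p q = hadamardForm q p := by
  rw [hadamardForm, hadamardForm, hadamard_symm]
  ac_rfl

theorem hadamardForm_signedPerm {σ : Perm (Fin 12)} {ε : Fin 12 → ℤˣ}
    (h : ∀ i j, ε i * hadamard (σ i) j = hadamard i (σ j) * ε j) (p q : SignedLetter) :
    hadamardForm (signedPerm σ ε p) q = hadamardForm p (signedPerm σ ε q) := by
  have := h p.1 q.1
  simp only [hadamardForm, signedPerm, coe_fn_mk]
  calc _ = p.2 * (ε p.1 * hadamard (σ p.1) q.1) * q.2 := by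
        rw [mul_comm (ε p.1) p.2]; simp only [mul_assoc]
    _ = _ := by rw [this]; simp only [mul_assoc]

/-! ### The double cover of the Mathieu group -/

/-- A pair of permutations of signed letters. -/
abbrev SignPermPair : Type := Perm SignedLetter × Perm SignedLetter

/-- `2.M₁₂`, acting on the signed letters `± e` in the given way and on the signed letters `± ē` in
its twin way. -/
def M12TildePair : Subgroup SignPermPair :=
  Subgroup.closure {(gen0Tilde, gen0Tilde⁻¹), (gen1Tilde, gen1Tilde⁻¹)}

/-- The central element `-1` of `2.M₁₂`. -/
def negOne : Perm SignedLetter := signedPerm 1 fun _ => -1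

theorem negOne_apply (p : SignedLetter) : negOne p = (p.1, -p.2) := by
  simp [negOne, signedPerm]

theorem negOne_mul_negOne : negOne * negOne = 1 := by
  ext p <;> simp [negOne_apply]

theorem negOne_ne_one : negOne ≠ 1 := by
  intro h
  have : negOne (0, 1) = (0, 1) := by rw [h]; rfl
  rw [negOne_apply] at this
  exact absurd (Prod.ext_iff.1 this).2 (by decide)

theorem signedPerm_commute_negOne (σ : Perm (Fin 12)) (ε : Fin 12 → ℤˣ) :
    signedPerm σ ε * negOne = negOne * signedPerm σ ε := by
  refine Equiv.ext fun p => ?_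
  rw [Perm.mul_apply, Perm.mul_apply, negOne_apply, negOne_apply]
  simp [signedPerm]

theorem commute_negOne_of_mem {g : Perm SignedLetter} (hg : g ∈ M12Tilde) :
    g * negOne = negOne * g := by
  have : M12Tilde ≤ Subgroup.centralizer {negOne} := by
    refine (Subgroup.closure_le _).2 ?_
    rintro _ (rfl | rfl) _ rfl
    exacts [(signedPerm_commute_negOne _ _).symm, (signedPerm_commute_negOne _ _).symm]
  exact (this hg negOne rfl).symm

namespace M12TildePair

/-- The two actions of `2.M₁₂` preserve the Hadamard matrix. -/
theorem hadamardForm_eq {g : SignPermPair} (hg : g ∈ M12TildePair) (p q : SignedLetter) :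
    hadamardForm (g.1 p) (g.2 q) = hadamardForm p q := by
  induction hg using Subgroup.closure_induction generalizing p q with
  | mem g hg =>
    rcases hg with rfl | rfl
    · have : ∀ i j, (1 : ℤˣ) * hadamard (gen0 i) j = hadamard i (gen0 j) * 1 := by decide +kernel
      exact (hadamardForm_signedPerm this p _).trans (by
        rw [← gen0Tilde]; simp)
    · have : ∀ i j, (if i = 11 ∨ i = 12 then (-1 : ℤˣ) else 1) * hadamard (gen1 i) j =
          hadamard i (gen1 j) * (if j = 11 ∨ j = 12 then -1 else 1) := by decide +kernel
      exact (hadamardForm_signedPerm this p _).trans (by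
        rw [← gen1Tilde]; simp)
  | one => rfl
  | mul g h _ _ hg hh => rw [Prod.fst_mul, Prod.snd_mul, Perm.mul_apply, Perm.mul_apply, hg, hh]
  | inv g _ hg => rw [← hg]; simp

theorem map_fst : M12TildePair.map (MonoidHom.fst _ _) = M12Tilde := by
  simp [M12Tilde, M12TildePair, MonoidHom.map_closure, Set.image_pair]

theorem fst_mem {g : SignPermPair} (hg : g ∈ M12TildePair) : g.1 ∈ M12Tilde := by
  rw [← map_fst]
  exact ⟨g, hg, rfl⟩

theorem exists_of_mem {g : Perm SignedLetter} (hg : g ∈ M12Tilde) :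
    ∃ p ∈ M12TildePair, p.1 = g := by
  rw [← map_fst] at hg
  exact hg

theorem gen0_mem : (gen0Tilde, gen0Tilde⁻¹) ∈ M12TildePair :=
  Subgroup.subset_closure (Set.mem_insert _ _)

theorem gen1_mem : (gen1Tilde, gen1Tilde⁻¹) ∈ M12TildePair :=
  Subgroup.subset_closure (Set.mem_insert_of_mem _ rfl)

theorem swap_mem {g : SignPermPair} (hg : g ∈ M12TildePair) : g.swap ∈ M12TildePair := by
  induction hg using Subgroup.closure_induction with
  | mem g hg =>
    rcases hg with rfl | rfl
    · simpa using inv_mem gen0_mem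
    · simpa using inv_mem gen1_mem
  | one => exact one_mem _
  | mul g h _ _ hg hh => exact mul_mem hg hh
  | inv g _ hg => exact inv_mem hg

theorem snd_mem {g : SignPermPair} (hg : g ∈ M12TildePair) : g.2 ∈ M12Tilde :=
  fst_mem (swap_mem hg)

theorem negOne_eq_pow : negOne = (gen0Tilde * gen1Tilde) ^ 11 := by decide +kernel

theorem negOne_eq_pow_inv : negOne = (gen0Tilde⁻¹ * gen1Tilde⁻¹) ^ 11 := by decide +kernel

theorem negOne_mem : (negOne, negOne) ∈ M12TildePair := by
  have : ((negOne, negOne) : SignPermPair) =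
      ((gen0Tilde, gen0Tilde⁻¹) * (gen1Tilde, gen1Tilde⁻¹)) ^ 11 :=
    Prod.ext (by rw [Prod.pow_fst]; exact negOne_eq_pow)
      (by rw [Prod.pow_snd]; exact negOne_eq_pow_inv)
  rw [this]
  exact pow_mem (mul_mem gen0_mem gen1_mem) _

/-- The columns of the Hadamard matrix are distinct, so that an element of `2.M₁₂` is determined by
its action on the letters `± e`. -/
theorem snd_eq_one {g : SignPermPair} (hg : g ∈ M12TildePair) (h : g.1 = 1) : g.2 = 1 := by
  have key : ∀ i j : Fin 12, ∀ s t : ℤˣ, (∀ k, hadamard k i * s = hadamard k j * t) → i = j := by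
    decide +kernel
  refine Equiv.ext fun p => ?_
  have h1 : ∀ k, hadamard k (g.2 p).1 * (g.2 p).2 = hadamard k p.1 * p.2 := fun k => by
    have := hadamardForm_eq hg (k, 1) p
    simpa [h, hadamardForm] using this
  have h2 : (g.2 p).1 = p.1 := key _ _ _ _ h1
  have h3 := h1 0
  rw [h2] at h3
  exact Prod.ext h2 (mul_left_cancel h3)

end M12TildePair

theorem negOne_mem : negOne ∈ M12Tilde := M12TildePair.fst_mem M12TildePair.negOne_mem

/-- Any two rows of the Hadamard matrix are separated from the other ten by four columns. -/
theorem exists_hadamard_columns (i : Fin 12) (hi : i ≠ 0) :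
    ∃ k l m : Fin 12, ∃ s t : ℤˣ, ∃ f : Fin 12 → ℤ,
      (∀ a, f a = ((hadamard a 0 : ℤ) + s * hadamard a k) * (hadamard a l + t * hadamard a m)) ∧
      f i = - f 0 ∧ (f 0 = 4 ∨ f 0 = -4) ∧ ∀ a, a ≠ 0 ∧ a ≠ i → f a = 0 := by
  have key : ∀ i ≠ 0, ∃ k l m : Fin 12, ∃ s t : ℤˣ,
      let f a := ((hadamard a 0 : ℤ) + s * hadamard a k) * (hadamard a l + t * hadamard a m)
      f i = - f 0 ∧ (f 0 = 4 ∨ f 0 = -4) ∧ ∀ a, a ≠ 0 ∧ a ≠ i → f a = 0 := by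
    decide +kernel
  obtain ⟨k, l, m, s, t, h⟩ := key i hi
  exact ⟨k, l, m, s, t, _, fun _ => rfl, h⟩

/-- The kernel of `2.M₁₂ → M₁₂` is `{1, -1}`: as `2.M₁₂` preserves the ternary Golay code spanned by
the columns of the Hadamard matrix, a change of signs in `2.M₁₂` makes all the sums of products of
two columns divisible by `3`. -/
theorem eq_one_or_eq_negOne {g : Perm SignedLetter} (hg : g ∈ M12Tilde) (h : LiesAbove g 1) :
    g = 1 ∨ g = negOne := by
  obtain ⟨p, hp, rfl⟩ := M12TildePair.exists_of_mem hg
  have h1 : ∀ q, (p.1 q).1 = q.1 := h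
  set ε : Fin 12 → ℤˣ := fun i => (p.1 (i, 1)).2 with hε
  have hform : ∀ j, ∃ j', ∃ s : ℤˣ, ∀ i, ε i * hadamard i j = s * hadamard i j' := fun j => by
    refine ⟨(p.2⁻¹ (j, 1)).1, (p.2⁻¹ (j, 1)).2, fun i => ?_⟩
    have := M12TildePair.hadamardForm_eq hp (i, 1) (p.2⁻¹ (j, 1))
    rw [Perm.coe_inv, Equiv.apply_symm_apply] at this
    simpa [hadamardForm, h1, hε, mul_comm] using this
  have hdvd : ∀ j k, (3 : ℤ) ∣ ∑ i, (ε i : ℤ) * hadamard i j * hadamard i k := fun j k => by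
    obtain ⟨j', s, hs⟩ := hform j
    have : ∑ i, (ε i : ℤ) * hadamard i j * hadamard i k
        = s * ∑ i, (hadamard i j' : ℤ) * hadamard i k := by
      rw [Finset.mul_sum]
      refine Finset.sum_congr rfl fun i _ => ?_
      rw [← Units.val_mul, hs i, Units.val_mul, mul_assoc]
    rw [this]
    exact (three_dvd_sum_hadamard j' k).mul_left _
  have hconst : ∀ i, ε i = ε 0 := fun i => by
    by_cases hi : i = 0
    · rw [hi]
    obtain ⟨k, l, m, s, t, f, hf, hfi, hf0, hfa⟩ := exists_hadamard_columns i hi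
    have h3 : (3 : ℤ) ∣ ∑ a, (ε a : ℤ) * f a := by
      have : ∑ a, (ε a : ℤ) * f a = ∑ a, (ε a : ℤ) * hadamard a 0 * hadamard a l
          + t * ∑ a, (ε a : ℤ) * hadamard a 0 * hadamard a m
          + s * ∑ a, (ε a : ℤ) * hadamard a k * hadamard a l
          + s * t * ∑ a, (ε a : ℤ) * hadamard a k * hadamard a m := by
        simp only [Finset.mul_sum, ← Finset.sum_add_distrib]
        refine Finset.sum_congr rfl fun a _ => ?_
        rw [hf]
        ring
      rw [this]
      exact (((hdvd _ _).add ((hdvd _ _).mul_left _)).add ((hdvd _ _).mul_left _)).add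
        ((hdvd _ _).mul_left _)
    rw [Fintype.sum_eq_add 0 i (Ne.symm hi) (fun a ha => by rw [hfa a ha, mul_zero]), hfi] at h3
    rcases Int.units_eq_one_or (ε i) with h4 | h4 <;> rcases Int.units_eq_one_or (ε 0) with h5 | h5
    · rw [h4, h5]
    · rw [h4, h5] at h3
      rcases hf0 with h6 | h6 <;> norm_num [h6] at h3
    · rw [h4, h5] at h3
      rcases hf0 with h6 | h6 <;> norm_num [h6] at h3
    · rw [h4, h5]
  have hval : ∀ i s, p.1 (i, s) = (i, ε 0 * s) := fun i s => by
    have h2 : p.1 (i, 1) = (i, ε 0) := Prod.ext (h1 _) (hconst i)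
    rcases Int.units_eq_one_or s with rfl | rfl
    · rw [h2, mul_one]
    · have h3 := congrArg (· (i, 1)) (commute_negOne_of_mem hg)
      simp only [Perm.mul_apply, negOne_apply, h2] at h3
      rw [h3, mul_neg, mul_one]
  rcases Int.units_eq_one_or (ε 0) with h2 | h2
  · left
    refine Equiv.ext fun q => ?_
    rw [hval q.1 q.2, h2, one_mul]
    rfl
  · right
    refine Equiv.ext fun q => ?_
    rw [hval q.1 q.2, h2, negOne_apply, neg_one_mul]

/-! ### The class `2A` and its lifts -/

theorem LiesAbove.mul {g' h' : Perm SignedLetter} {g h : Perm (Fin 12)} (hg : LiesAbove g' g)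
    (hh : LiesAbove h' h) : LiesAbove (g' * h') (g * h) := fun p => by
  rw [Perm.mul_apply, Perm.mul_apply, hg, hh]

theorem LiesAbove.inv {g' : Perm SignedLetter} {g : Perm (Fin 12)} (hg : LiesAbove g' g) :
    LiesAbove g'⁻¹ g⁻¹ := fun p => by
  rw [eq_comm, Perm.inv_eq_iff_eq, ← hg, Perm.coe_inv, Equiv.apply_symm_apply]

theorem LiesAbove.one : LiesAbove 1 1 := fun _ => rfl

theorem liesAbove_signedPerm (σ : Perm (Fin 12)) (ε : Fin 12 → ℤˣ) :
    LiesAbove (signedPerm σ ε) σ := fun _ => rfl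

theorem exists_liesAbove {g : Perm (Fin 12)} (hg : g ∈ M12) : ∃ g' ∈ M12Tilde, LiesAbove g' g := by
  induction hg using Subgroup.closure_induction with
  | mem g hg =>
    rcases hg with rfl | rfl
    · exact ⟨gen0Tilde, Subgroup.subset_closure (by simp), liesAbove_signedPerm _ _⟩
    · exact ⟨gen1Tilde, Subgroup.subset_closure (by simp), liesAbove_signedPerm _ _⟩
  | one => exact ⟨1, one_mem _, LiesAbove.one⟩
  | mul g h _ _ hg hh =>
    obtain ⟨g', hg', hg⟩ := hg
    obtain ⟨h', hh', hh⟩ := hh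
    exact ⟨g' * h', mul_mem hg' hh', hg.mul hh⟩
  | inv g _ hg =>
    obtain ⟨g', hg', hg⟩ := hg
    exact ⟨g'⁻¹, inv_mem hg', hg.inv⟩

theorem exists_liesAbove' {g' : Perm SignedLetter} (hg : g' ∈ M12Tilde) :
    ∃ g ∈ M12, LiesAbove g' g := by
  induction hg using Subgroup.closure_induction with
  | mem g hg =>
    rcases hg with rfl | rfl
    · exact ⟨gen0, Subgroup.subset_closure (by simp), liesAbove_signedPerm _ _⟩
    · exact ⟨gen1, Subgroup.subset_closure (by simp), liesAbove_signedPerm _ _⟩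
  | one => exact ⟨1, one_mem _, LiesAbove.one⟩
  | mul g h _ _ hg hh =>
    obtain ⟨g', hg', hg⟩ := hg
    obtain ⟨h', hh', hh⟩ := hh
    exact ⟨g' * h', mul_mem hg' hh', hg.mul hh⟩
  | inv g _ hg =>
    obtain ⟨g', hg', hg⟩ := hg
    exact ⟨g'⁻¹, inv_mem hg', hg.inv⟩

theorem eq_of_liesAbove {g' h' : Perm SignedLetter} {g : Perm (Fin 12)} (hg' : g' ∈ M12Tilde)
    (hh' : h' ∈ M12Tilde) (hg : LiesAbove g' g) (hh : LiesAbove h' g) :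
    g' = h' ∨ g' = negOne * h' := by
  have h1 : LiesAbove (g' * h'⁻¹) 1 := mul_inv_cancel g ▸ hg.mul hh.inv
  refine (eq_one_or_eq_negOne (mul_mem hg' (inv_mem hh')) h1).imp mul_inv_eq_one.1 fun h => ?_
  rw [← h, inv_mul_cancel_right]

/-- A lift of `rep2A` to `2.M₁₂`. -/
def rep2ATilde : Perm SignedLetter :=
  (gen0Tilde * gen1Tilde * gen0Tilde * gen1Tilde * gen0Tilde⁻¹ * gen1Tilde) ^ 3

theorem gen0Tilde_mem : gen0Tilde ∈ M12Tilde := Subgroup.subset_closure (Set.mem_insert _ _)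

theorem gen1Tilde_mem : gen1Tilde ∈ M12Tilde :=
  Subgroup.subset_closure (Set.mem_insert_of_mem _ rfl)

theorem rep2ATilde_mem : rep2ATilde ∈ M12Tilde :=
  pow_mem (mul_mem (mul_mem (mul_mem (mul_mem (mul_mem gen0Tilde_mem gen1Tilde_mem) gen0Tilde_mem)
    gen1Tilde_mem) (inv_mem gen0Tilde_mem)) gen1Tilde_mem) _

theorem liesAbove_rep2ATilde : LiesAbove rep2ATilde rep2A := by
  have ha : LiesAbove gen0Tilde gen0 := liesAbove_signedPerm _ _
  have hb : LiesAbove gen1Tilde gen1 := liesAbove_signedPerm _ _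
  have h := ((((ha.mul hb).mul ha).mul hb).mul ha.inv).mul hb
  rw [rep2ATilde, rep2A, pow_succ, pow_two, pow_succ, pow_two]
  exact (h.mul h).mul h

theorem rep2ATilde_mul_self : rep2ATilde * rep2ATilde = negOne := by decide +kernel

/-- The two lifts of `rep2A` are conjugate. -/
theorem exists_conj_rep2ATilde : ∃ k ∈ M12Tilde, k * rep2ATilde * k⁻¹ = negOne * rep2ATilde := by
  obtain ⟨x, hx⟩ : ∃ x, x = gen0Tilde * gen1Tilde := ⟨_, rfl⟩
  obtain ⟨y, hy⟩ : ∃ y, y = gen0Tilde⁻¹ * gen1Tilde := ⟨_, rfl⟩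
  have hx' : x ∈ M12Tilde := hx ▸ mul_mem gen0Tilde_mem gen1Tilde_mem
  have hy' : y ∈ M12Tilde := hy ▸ mul_mem (inv_mem gen0Tilde_mem) gen1Tilde_mem
  refine ⟨y * x * x * y * y * x * y * x * x * x * y * x, ?_, ?_⟩
  · repeat' first | exact hx' | exact hy' | apply mul_mem
  · rw [hx, hy, mul_inv_eq_iff_eq_mul]
    decide +kernel

theorem exists_conj_of_class2A {g : Perm (Fin 12)} (hg : g ∈ class2A) {g' : Perm SignedLetter}
    (hg' : g' ∈ M12Tilde) (h : LiesAbove g' g) : ∃ k ∈ M12Tilde, k * rep2ATilde * k⁻¹ = g' := by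
  obtain ⟨n, hn, rfl⟩ := hg
  obtain ⟨n', hn', hnn⟩ := exists_liesAbove hn
  rcases eq_of_liesAbove hg' (mul_mem (mul_mem hn' rep2ATilde_mem) (inv_mem hn')) h
    ((hnn.mul liesAbove_rep2ATilde).mul hnn.inv) with rfl | rfl
  · exact ⟨n', hn', rfl⟩
  · obtain ⟨k, hk, hkr⟩ := exists_conj_rep2ATilde
    refine ⟨n' * k, mul_mem hn' hk, ?_⟩
    calc _ = n' * (k * rep2ATilde * k⁻¹) * n'⁻¹ := by group
      _ = _ := by rw [hkr, ← mul_assoc, commute_negOne_of_mem hn']; group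

/-- The elements of `2.M₁₂` above the class `2A` are square roots of `-1`. -/
theorem mul_self_eq_negOne_of_class2A {g : Perm (Fin 12)} (hg : g ∈ class2A)
    {g' : Perm SignedLetter} (hg' : g' ∈ M12Tilde) (h : LiesAbove g' g) : g' * g' = negOne := by
  obtain ⟨k, hk, rfl⟩ := exists_conj_of_class2A hg hg' h
  calc _ = k * (rep2ATilde * rep2ATilde) * k⁻¹ := by group
    _ = _ := by rw [rep2ATilde_mul_self, commute_negOne_of_mem hk, mul_inv_cancel_right]

/-! ### Cycle types -/

/-- If `f` has order `p ^ (n + 1)` and `f ^ p ^ n` has no fixed points, then all the cycles of `f`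
have length `p ^ (n + 1)`. -/
theorem cycleType_eq_replicate {α : Type*} [Fintype α] [DecidableEq α] {p n : ℕ} (hp : p.Prime)
    {f : Perm α} (hf : f ^ p ^ (n + 1) = 1) (hfix : ∀ x, (f ^ p ^ n) x ≠ x) :
    p ^ (n + 1) * f.cycleType.card = Fintype.card α ∧
      f.cycleType = Multiset.replicate f.cycleType.card (p ^ (n + 1)) := by
  have h1 : ∀ m ∈ f.cycleType, m = p ^ (n + 1) := fun m hm => by
    obtain ⟨k, hk, rfl⟩ := (Nat.dvd_prime_pow hp).1
      ((Perm.dvd_of_mem_cycleType hm).trans (orderOf_dvd_of_pow_eq_one hf))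
    rcases Nat.lt_or_ge k (n + 1) with hlt | hge
    · exfalso
      obtain ⟨c, τ, rfl, hd, hc, hcard⟩ := Perm.mem_cycleType_iff.1 hm
      have hc' := hc
      obtain ⟨x, hx, -⟩ := hc
      have hτ : τ x = x := (hd x).resolve_left hx
      have h2 : ((c * τ) ^ p ^ k) x = x := by
        rw [hd.commute.mul_pow, ← hcard, ← hc'.orderOf, pow_orderOf_eq_one, one_mul]
        exact Perm.pow_apply_eq_self_of_apply_eq_self hτ _
      refine hfix x ?_
      rw [← Nat.add_sub_of_le (Nat.lt_succ_iff.1 hlt), pow_add, pow_mul]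
      exact Perm.pow_apply_eq_self_of_apply_eq_self h2 _
    · rw [le_antisymm hk hge]
  have h2 := Multiset.eq_replicate_card.2 h1
  refine ⟨?_, h2⟩
  have h3 := f.sum_cycleType
  rw [h2, Multiset.sum_replicate, smul_eq_mul, mul_comm] at h3
  rw [h3, Finset.eq_univ_of_forall (s := f.support) fun x => ?_, Finset.card_univ]
  rw [Perm.mem_support]
  intro h
  exact hfix x (Perm.pow_apply_eq_self_of_apply_eq_self h _)

/-! ### Actions of the double cover on at most twelve points -/

theorem gen0Tilde_pow_three : gen0Tilde ^ 3 = 1 := by decide +kernel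

theorem gen1Tilde_mul_self : gen1Tilde * gen1Tilde = 1 := by decide +kernel

/-- `gen1Tilde` is the fourth power of an element of order `8`. -/
theorem exists_pow_four_eq_gen1Tilde : ∃ y ∈ M12Tilde, y ^ 4 = gen1Tilde := by
  obtain ⟨a, ha⟩ : ∃ a, a = gen0Tilde := ⟨_, rfl⟩
  obtain ⟨x, hx⟩ : ∃ x, x = gen0Tilde * gen1Tilde := ⟨_, rfl⟩
  obtain ⟨y, hy⟩ : ∃ y, y = gen0Tilde⁻¹ * gen1Tilde := ⟨_, rfl⟩
  have ha' : a ∈ M12Tilde := ha ▸ gen0Tilde_mem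
  have hx' : x ∈ M12Tilde := hx ▸ mul_mem gen0Tilde_mem gen1Tilde_mem
  have hy' : y ∈ M12Tilde := hy ▸ mul_mem (inv_mem gen0Tilde_mem) gen1Tilde_mem
  refine ⟨y * x * x * x * a⁻¹ * (x * x * x * y * x * y * y) * (y * x * x * x * a⁻¹)⁻¹, ?_, ?_⟩
  · repeat' first | exact hx' | exact hy' | exact ha' | apply mul_mem | apply inv_mem
  · rw [conj_pow, mul_inv_eq_iff_eq_mul, ha, hx, hy]
    decide +kernel

/-- As `2.M₁₂` is perfect, it is the normal closure of any of its elements that is not central. For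
the square of `γ₀γ₁`, this follows from a few relations between the generators. -/
theorem eq_one_of_map_eq_one {H : Type*} [Group H] (φ : M12Tilde →* H)
    (h : φ (⟨gen0Tilde, gen0Tilde_mem⟩ * ⟨gen1Tilde, gen1Tilde_mem⟩) ^ 2 = 1) : φ = 1 := by
  obtain ⟨a, ha⟩ : ∃ a : M12Tilde, a = ⟨gen0Tilde, gen0Tilde_mem⟩ := ⟨_, rfl⟩
  obtain ⟨b, hb⟩ : ∃ b : M12Tilde, b = ⟨gen1Tilde, gen1Tilde_mem⟩ := ⟨_, rfl⟩
  rw [← ha, ← hb, map_mul] at h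
  have ha3 : φ a ^ 3 = 1 := by
    rw [← map_pow, ha, show (⟨gen0Tilde, gen0Tilde_mem⟩ : M12Tilde) ^ 3 = 1 from
      Subtype.ext gen0Tilde_pow_three, map_one]
  have hb2 : φ b * φ b = 1 := by
    rw [← map_mul, hb, show (⟨gen1Tilde, gen1Tilde_mem⟩ * ⟨gen1Tilde, gen1Tilde_mem⟩ : M12Tilde) = 1
      from Subtype.ext gen1Tilde_mul_self, map_one]
  have hrel : (a * b) ^ 11 = (a * b * a * b * a⁻¹ * b) ^ 3 * (a * b * a * b * a⁻¹ * b) ^ 3 := by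
    rw [ha, hb]
    exact Subtype.ext (M12TildePair.negOne_eq_pow.symm.trans rep2ATilde_mul_self.symm)
  have hrel' := congrArg φ hrel
  simp only [map_mul, map_pow, map_inv] at hrel'
  suffices key : φ a = 1 ∧ φ b = 1 by
    have hle : M12Tilde ≤ φ.ker.map M12Tilde.subtype := by
      refine (Subgroup.closure_le _).2 ?_
      rintro g (rfl | rfl)
      · exact ⟨a, key.1, by rw [ha]; rfl⟩
      · exact ⟨b, key.2, by rw [hb]; rfl⟩
    ext g
    obtain ⟨g', hg', hgg⟩ := hle g.2
    rw [← Subtype.ext hgg, MonoidHom.mem_ker.1 hg', MonoidHom.one_apply]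
  generalize φ a = α at *
  generalize φ b = β at *
  -- the relations say that `α` and `β` generate a quotient of `S₃`, in which `hrel` gives `αβ = 1`
  have hβ : β⁻¹ = β := inv_eq_of_mul_eq_one_left hb2
  have hab : α * β * α * β = 1 := by rw [← h, pow_two, ← mul_assoc]
  have hαβ : α⁻¹ * β = β * α := by
    rw [inv_mul_eq_iff_eq_mul]
    calc β = (α * β * α * β) * β⁻¹ := by rw [hab, one_mul, hβ]
      _ = α * (β * α) := by group
  have hba : β * α * (β * α) = 1 := by
    calc _ = β * (α * β * α * β) * β⁻¹ := by group
      _ = 1 := by rw [hab]; group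
  have h1 : α * β = 1 := by
    have h2 : (α * β) ^ 11 = α * β := by
      rw [show 11 = 2 * 5 + 1 from rfl, pow_succ, pow_mul, h, one_pow, one_mul]
    rw [h2, hab, one_mul, hαβ] at hrel'
    rw [hrel', ← (Commute.refl (β * α)).mul_pow, hba, one_pow]
  have h2 : α = β := by rw [eq_inv_of_mul_eq_one_left h1, hβ]
  have h3 : β = 1 := by
    rw [h2, pow_succ, pow_two, hb2, one_mul] at ha3
    exact ha3
  exact ⟨h2.trans h3, h3⟩

/-- On a set of at most twelve points, a permutation of order two that commutes with a permutation
of order eleven is trivial. -/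
theorem eq_one_of_commute_of_orderOf_eq_eleven {X : Type*} [Fintype X] (hX : Fintype.card X ≤ 12)
    {z ζ : Perm X} (hz : orderOf z = 11) (hζ : ζ * ζ = 1) (hc : Commute ζ z) : ζ = 1 := by
  classical
  have hp : Nat.Prime 11 := by norm_num
  have hcyc : z.IsCycle := Perm.isCycle_of_prime_order' (hz ▸ hp) (by omega)
  have hcard : z.support.card = 11 := by rw [← hcyc.orderOf, hz]
  have hcx : ∀ x, ζ (z x) = z (ζ x) := fun x => DFunLike.congr_fun hc.eq x
  have hsupp : ∀ x, x ∈ z.support ↔ ζ x ∈ z.support := fun x => by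
    rw [Perm.mem_support, Perm.mem_support, ← hcx, ζ.injective.ne_iff]
  have hζζ : ∀ x, ζ (ζ x) = x := fun x => DFunLike.congr_fun hζ x
  -- an involution of a set of odd cardinality has a fixed point
  obtain ⟨⟨x, hx⟩, hfix⟩ := Perm.exists_fixed_point_of_prime (p := 2) (n := 1)
    (σ := ζ.subtypePerm (p := (· ∈ z.support)) fun x => (hsupp x).symm)
    (by rw [Fintype.card_coe, hcard]; decide)
    (by ext x; simp [pow_two, hζζ])
  replace hfix : ζ x = x := congrArg Subtype.val hfix
  have hon : ∀ y ∈ z.support, ζ y = y := fun y hy => by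
    obtain ⟨n, rfl⟩ := hcyc.sameCycle (Perm.mem_support.1 hx) (Perm.mem_support.1 hy)
    rw [← Perm.mul_apply, (hc.zpow_right n).eq, Perm.mul_apply, hfix]
  ext y
  by_cases hy : y ∈ z.support
  · exact hon y hy
  -- at most one point is left
  have hle : z.supportᶜ.card ≤ 1 := by rw [Finset.card_compl, hcard]; omega
  exact Finset.card_le_one.1 hle _ (Finset.mem_compl.2 fun h => hy ((hsupp y).2 h)) _
    (Finset.mem_compl.2 hy)

/-- Involutions of `2.M₁₂` have fixed points in every action on at most twelve points. This is what
forces a real embedding of a field of degree at most twelve inside a field with group `2.M₁₂`. -/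
theorem exists_fixed_of_mul_self {X : Type*} [Fintype X] [Nonempty X] (hX : Fintype.card X ≤ 12)
    (φ : M12Tilde →* Perm X) (c : M12Tilde) (hc : c * c = 1) : ∃ x, φ c x = x := by
  classical
  obtain ⟨t, ht⟩ : ∃ t : M12Tilde, t = ⟨gen0Tilde, gen0Tilde_mem⟩ * ⟨gen1Tilde, gen1Tilde_mem⟩ :=
    ⟨_, rfl⟩
  obtain ⟨n, hn⟩ : ∃ n : M12Tilde, n = ⟨negOne, negOne_mem⟩ := ⟨_, rfl⟩
  have htn : t ^ 11 = n := by rw [ht, hn]; exact Subtype.ext M12TildePair.negOne_eq_pow.symm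
  have hnn : n * n = 1 := by rw [hn]; exact Subtype.ext negOne_mul_negOne
  by_cases hz : φ t ^ 2 = 1
  · rw [eq_one_of_map_eq_one φ (ht ▸ hz)]
    exact ⟨Classical.arbitrary X, rfl⟩
  have hord : orderOf (φ t ^ 2) = 11 := by
    have : Fact (Nat.Prime 11) := ⟨by norm_num⟩
    refine orderOf_eq_prime ?_ hz
    rw [← pow_mul, mul_comm, pow_mul, ← map_pow, htn, pow_two, ← map_mul, hnn, map_one]
  have hφn : φ n = 1 := by
    refine eq_one_of_commute_of_orderOf_eq_eleven hX hord (by rw [← map_mul, hnn, map_one]) ?_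
    rw [← htn, map_pow]
    exact (Commute.refl _).pow_pow _ _
  have hX11 : 11 ≤ Fintype.card X := by
    by_contra hlt
    have := orderOf_dvd_card (x := φ t ^ 2)
    rw [hord, Fintype.card_perm, Nat.Prime.dvd_factorial (by norm_num)] at this
    exact hlt this
  have hcc : (c : Perm SignedLetter) * c = 1 := congrArg Subtype.val hc
  obtain ⟨g, hg, hcg⟩ := exists_liesAbove' c.2
  have hcentral : ∀ d : M12Tilde, c = d ∨ (c : Perm SignedLetter) = negOne * d → φ c = φ d := by
    rintro d (h | h)
    · rw [h]
    · have : c = n * d := Subtype.ext (by rw [h, hn]; rfl)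
      rw [this, map_mul, hφn, one_mul]
  by_cases hg1 : g = 1
  · subst hg1
    refine ⟨Classical.arbitrary X, ?_⟩
    rw [hcentral 1, map_one, Perm.one_apply]
    rcases eq_one_or_eq_negOne c.2 hcg with h | h
    · exact Or.inl (Subtype.ext h)
    · exact Or.inr (by rw [h]; rfl)
  have hgg : g * g = 1 := by
    have h := hcg.mul hcg
    rw [hcc] at h
    ext e
    exact congrArg Fin.val (h (e, 1)).symm
  rcases involution_of_mem_M12 hg hgg hg1 with h2A | ⟨h, hh, rfl⟩
  · exact absurd ((mul_self_eq_negOne_of_class2A h2A c.2 hcg).symm.trans hcc) negOne_ne_one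
  obtain ⟨h', hh', hab⟩ := exists_liesAbove hh
  obtain ⟨y, hy, hy4⟩ := exists_pow_four_eq_gen1Tilde
  obtain ⟨k, hk⟩ : ∃ k : M12Tilde, k = ⟨h', hh'⟩ := ⟨_, rfl⟩
  obtain ⟨Y, hY⟩ : ∃ Y : M12Tilde, Y = ⟨y, hy⟩ := ⟨_, rfl⟩
  have hY4 : (Y ^ 4 : M12Tilde) = ⟨gen1Tilde, gen1Tilde_mem⟩ := by rw [hY]; exact Subtype.ext hy4
  have hφc : φ c = φ k * φ Y ^ 4 * (φ k)⁻¹ := by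
    rw [← map_pow, ← map_inv, ← map_mul, ← map_mul]
    refine hcentral _ ?_
    have := eq_of_liesAbove (h' := h' * gen1Tilde * h'⁻¹) c.2
      (mul_mem (mul_mem hh' gen1Tilde_mem) (inv_mem hh')) hcg
      ((hab.mul (liesAbove_signedPerm _ _)).mul hab.inv)
    rw [hY4, hk]
    exact this.imp (fun h => Subtype.ext h) id
  -- without fixed points, the elements of order eight would have cycles of length eight only
  by_contra! hfix
  have hY8 : φ Y ^ 2 ^ (2 + 1) = 1 := by
    have h8 : Y ^ 8 = 1 := by
      rw [show 8 = 4 * 2 from rfl, pow_mul, hY4, pow_two]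
      exact Subtype.ext gen1Tilde_mul_self
    rw [← map_pow, show 2 ^ (2 + 1) = 8 from rfl, h8, map_one]
  have hYfix : ∀ x, (φ Y ^ 2 ^ 2) x ≠ x := fun x hx => by
    refine hfix (φ k x) ?_
    rw [hφc]
    simpa using hx
  -- but neither `11` nor `12` is divisible by `8`
  have := (cycleType_eq_replicate Nat.prime_two hY8 hYfix).1
  omega

/-! ### The extensions by an outer element -/

/-- If `σ` normalizes `N` and has its square in `N`, then `N` and `N σ` make up a group. -/
theorem mem_or_of_mem_closure_insert {G : Type*} [Group G] {N : Subgroup G} {S : Set G} {σ : G}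
    (hS : S ⊆ N) (hσ : ∀ n ∈ N, σ * n * σ⁻¹ ∈ N) (hσσ : σ * σ ∈ N) {g : G}
    (hg : g ∈ Subgroup.closure (insert σ S)) : g ∈ N ∨ ∃ n ∈ N, g = n * σ := by
  induction hg using Subgroup.closure_induction with
  | mem x hx =>
    rcases hx with rfl | hx
    · exact Or.inr ⟨1, one_mem _, (one_mul _).symm⟩
    · exact Or.inl (hS hx)
  | one => exact Or.inl (one_mem _)
  | mul x y _ _ hx hy =>
    rcases hx with hx | ⟨m, hm, rfl⟩ <;> rcases hy with hy | ⟨n, hn, rfl⟩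
    · exact Or.inl (mul_mem hx hy)
    · exact Or.inr ⟨x * n, mul_mem hx hn, by group⟩
    · exact Or.inr ⟨m * (σ * y * σ⁻¹), mul_mem hm (hσ _ hy), by group⟩
    · refine Or.inl ?_
      rw [show m * σ * (n * σ) = m * (σ * n * σ⁻¹) * (σ * σ) by group]
      exact mul_mem (mul_mem hm (hσ _ hn)) hσσ
  | inv x _ hx =>
    rcases hx with hx | ⟨m, hm, rfl⟩
    · exact Or.inl (inv_mem hx)
    · refine Or.inr ⟨(σ * σ)⁻¹ * (σ * m⁻¹ * σ⁻¹),
        mul_mem (inv_mem hσσ) (hσ _ (inv_mem hm)), by group⟩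

/-- The subgroup `M₁₂` of index two of `M₁₂.2`. -/
def M12Dot2Inner : Subgroup (Perm (Fin 12 ⊕ Fin 12)) :=
  M12Pair.map (Perm.sumCongrHom (Fin 12) (Fin 12))

/-- The subgroup `2.M₁₂` of index two of `(2.M₁₂.2)*`. -/
def M12Dot2StarInner : Subgroup (Perm (SignedLetter ⊕ SignedLetter)) :=
  M12TildePair.map (Perm.sumCongrHom SignedLetter SignedLetter)

theorem sumComm_mul_sumCongr {α : Type*} (x y : Perm α) :
    (Equiv.sumComm α α : Perm (α ⊕ α)) * Perm.sumCongr x y = Perm.sumCongr y x * sumComm α α := by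
  ext (p | p) <;> rfl

theorem sumComm_mul_self {α : Type*} : (Equiv.sumComm α α : Perm (α ⊕ α)) * sumComm α α = 1 := by
  ext (p | p) <;> rfl

theorem starSwap_eq : starSwap = Perm.sumCongr negOne 1 * sumComm SignedLetter SignedLetter := by
  ext (p | p) <;> simp [starSwap, negOne_apply]

theorem starSwap_mul_sumCongr {x y : Perm SignedLetter} (hy : y * negOne = negOne * y) :
    starSwap * Perm.sumCongr x y = Perm.sumCongr y x * starSwap := by
  rw [starSwap_eq, mul_assoc, sumComm_mul_sumCongr, ← mul_assoc, ← mul_assoc, Perm.sumCongr_mul,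
    Perm.sumCongr_mul, hy, one_mul, mul_one]

theorem starSwap_mul_self : starSwap * starSwap = Perm.sumCongr negOne negOne := by
  ext (p | p) <;> simp [starSwap, negOne_apply]

theorem mem_inner_or_of_mem_M12Dot2 {g : Perm (Fin 12 ⊕ Fin 12)} (hg : g ∈ M12Dot2) :
    g ∈ M12Dot2Inner ∨ ∃ p ∈ M12Pair, g = Perm.sumCongr p.1 p.2 * sumComm (Fin 12) (Fin 12) := by
  have hg' : g ∈ Subgroup.closure (insert (sumComm (Fin 12) (Fin 12) : Perm (Fin 12 ⊕ Fin 12))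
      {Perm.sumCongr gen0 gen0⁻¹, Perm.sumCongr gen1 gen1⁻¹}) := by
    refine Subgroup.closure_mono ?_ hg
    rintro x (rfl | rfl | rfl) <;> simp
  refine (mem_or_of_mem_closure_insert (N := M12Dot2Inner) ?_ ?_ ?_ hg').imp_right ?_
  · rintro x (rfl | rfl)
    · exact ⟨(gen0, gen0⁻¹), Subgroup.subset_closure (by simp), rfl⟩
    · exact ⟨(gen1, gen1⁻¹), Subgroup.subset_closure (by simp), rfl⟩
  · rintro _ ⟨p, hp, rfl⟩
    refine ⟨p.swap, M12Pair.swap_mem hp, ?_⟩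
    rw [eq_mul_inv_iff_mul_eq]
    exact (sumComm_mul_sumCongr _ _).symm
  · rw [sumComm_mul_self]
    exact one_mem _
  · rintro ⟨_, ⟨p, hp, rfl⟩, rfl⟩
    exact ⟨p, hp, rfl⟩

theorem mem_inner_or_of_mem_M12Dot2Star {g : Perm (SignedLetter ⊕ SignedLetter)}
    (hg : g ∈ M12Dot2Star) :
    g ∈ M12Dot2StarInner ∨ ∃ p ∈ M12TildePair, g = Perm.sumCongr p.1 p.2 * starSwap := by
  have hg' : g ∈ Subgroup.closure (insert starSwap
      {Perm.sumCongr gen0Tilde gen0Tilde⁻¹, Perm.sumCongr gen1Tilde gen1Tilde⁻¹}) := by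
    refine Subgroup.closure_mono ?_ hg
    rintro x (rfl | rfl | rfl) <;> simp
  refine (mem_or_of_mem_closure_insert (N := M12Dot2StarInner) ?_ ?_ ?_ hg').imp_right ?_
  · rintro x (rfl | rfl)
    · exact ⟨_, M12TildePair.gen0_mem, rfl⟩
    · exact ⟨_, M12TildePair.gen1_mem, rfl⟩
  · rintro _ ⟨p, hp, rfl⟩
    refine ⟨p.swap, M12TildePair.swap_mem hp, ?_⟩
    rw [eq_mul_inv_iff_mul_eq]
    exact (starSwap_mul_sumCongr (commute_negOne_of_mem (M12TildePair.snd_mem hp))).symm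
  · rw [starSwap_mul_self]
    exact ⟨_, M12TildePair.negOne_mem, rfl⟩
  · rintro ⟨_, ⟨p, hp, rfl⟩, rfl⟩
    exact ⟨p, hp, rfl⟩

theorem M12Dot2StarInner_le : M12Dot2StarInner ≤ M12Dot2Star := by
  rw [M12Dot2StarInner, M12TildePair, MonoidHom.map_closure, Set.image_pair]
  refine Subgroup.closure_mono ?_
  rintro x (rfl | rfl)
  · exact Or.inl rfl
  · exact Or.inr (Or.inl rfl)

theorem starSwap_mem : starSwap ∈ M12Dot2Star := Subgroup.subset_closure (by simp)

theorem mul_self_mem_M12Dot2Inner {g : Perm (Fin 12 ⊕ Fin 12)} (hg : g ∈ M12Dot2) :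
    g * g ∈ M12Dot2Inner := by
  rcases mem_inner_or_of_mem_M12Dot2 hg with h | ⟨p, hp, rfl⟩
  · exact mul_mem h h
  · refine ⟨p * p.swap, mul_mem hp (M12Pair.swap_mem hp), ?_⟩
    rw [map_mul, mul_assoc (Perm.sumCongr p.1 p.2), ← mul_assoc (Equiv.sumComm _ _ : Perm _),
      sumComm_mul_sumCongr, mul_assoc (Perm.sumCongr p.2 p.1), sumComm_mul_self, mul_one]
    rfl

/-- An element of `M₁₂.2` with an odd power in `M₁₂` is in `M₁₂`. -/
theorem mem_M12Dot2Inner_of_pow {g : Perm (Fin 12 ⊕ Fin 12)} (hg : g ∈ M12Dot2) {n : ℕ}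
    (h : g ^ (2 * n + 1) ∈ M12Dot2Inner) : g ∈ M12Dot2Inner := by
  rw [pow_succ, pow_mul, pow_two] at h
  exact (Subgroup.mul_mem_cancel_left _ (pow_mem (mul_self_mem_M12Dot2Inner hg) n)).1 h

theorem M12Dot2Inner_le : M12Dot2Inner ≤ M12Dot2 := by
  rw [M12Dot2Inner, M12Pair, MonoidHom.map_closure, Set.image_pair]
  refine Subgroup.closure_mono ?_
  rintro x (rfl | rfl)
  · exact Or.inl rfl
  · exact Or.inr (Or.inl rfl)

theorem exists_mem_M12Dot2_apply_eq (i j : Fin 12 ⊕ Fin 12) : ∃ g ∈ M12Dot2, g i = j := by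
  -- all letters are images of the first one
  have key : ∀ j, ∃ g ∈ M12Dot2, g (Sum.inl 0) = j := by
    rintro (j | j)
    · obtain ⟨p, hp, h1, -⟩ := M12Pair.exists_twin j 0
      exact ⟨_, M12Dot2Inner_le ⟨p, hp, rfl⟩, congrArg Sum.inl h1⟩
    · obtain ⟨p, hp, -, h2⟩ := M12Pair.exists_twin 0 j
      exact ⟨_, mul_mem (M12Dot2Inner_le ⟨p, hp, rfl⟩)
        (Subgroup.subset_closure (Or.inr (Or.inr rfl))), congrArg Sum.inr h2⟩
  obtain ⟨g, hg, rfl⟩ := key i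
  obtain ⟨h, hh, rfl⟩ := key j
  exact ⟨h * g⁻¹, mul_mem hh (inv_mem hg), by simp⟩

/-- The involutions of `M₁₂.2` outside `M₁₂` form the class `2C`. -/
theorem mem_class2C {g : Perm (Fin 12 ⊕ Fin 12)} (hg : g ∈ M12Dot2) (hgg : g * g = 1)
    (hout : g ∉ M12Dot2Inner) : g ∈ class2C := by
  obtain ⟨⟨x, y⟩, hp, rfl⟩ := (mem_inner_or_of_mem_M12Dot2 hg).resolve_left hout
  have hxy : x * y = 1 := Equiv.ext fun i => Sum.inl_injective (DFunLike.congr_fun hgg (Sum.inl i))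
  obtain ⟨h, hh, hh1⟩ := M12Pair.exists_twisted_conj hp hxy
  refine ⟨Perm.sumCongr h.1 h.2, M12Dot2Inner_le ⟨h, hh, rfl⟩, ?_⟩
  rw [mul_inv_eq_iff_eq_mul, mul_assoc (Perm.sumCongr x y), sumComm_mul_sumCongr, ← mul_assoc,
    Perm.sumCongr_mul]
  have hy : y * h.1 = h.2 := by rw [hh1, ← mul_assoc, mul_eq_one_iff_eq_inv'.1 hxy]; simp
  exact congrArg₂ (fun a b => Perm.sumCongr a b * sumComm (Fin 12) (Fin 12)) hh1 hy.symm

/-- The outer elements of `(2.M₁₂.2)*` are not involutions: they change the sign of the Hadamard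
form, extended symmetrically to the signed letters of both kinds. An involution `g` would give
`hadamardForm s (g s) = -hadamardForm (g s) s`. -/
theorem mul_self_ne_one_of_outer {p : SignPermPair} (hp : p ∈ M12TildePair) :
    Perm.sumCongr p.1 p.2 * starSwap * (Perm.sumCongr p.1 p.2 * starSwap) ≠ 1 := by
  intro h
  have h0 : p.1 (negOne (p.2 (0, 1))) = (0, 1) := by
    refine Sum.inl_injective (Eq.trans ?_ (DFunLike.congr_fun h (Sum.inl (0, 1))))
    rw [negOne_apply]
    rfl
  have h1 := M12TildePair.hadamardForm_eq hp (negOne (p.2 (0, 1))) (0, 1)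
  rw [h0, hadamardForm_symm, negOne_apply] at h1
  have h2 : hadamardForm ((p.2 (0, 1)).1, -(p.2 (0, 1)).2) (0, 1) =
      - hadamardForm (p.2 (0, 1)) (0, 1) := by
    simp [hadamardForm]
  rw [h2] at h1
  exact units_ne_neg_self _ h1

theorem mem_M12Dot2StarInner_of_mul_self {g : Perm (SignedLetter ⊕ SignedLetter)}
    (hg : g ∈ M12Dot2Star) (hgg : g * g = 1) : g ∈ M12Dot2StarInner := by
  rcases mem_inner_or_of_mem_M12Dot2Star hg with h | ⟨p, hp, rfl⟩
  · exact h
  · exact absurd hgg (mul_self_ne_one_of_outer hp)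

theorem M12TildePair.eq_one_or_eq_negOne {p : SignPermPair} (hp : p ∈ M12TildePair)
    (h : LiesAbove p.1 1) : p = 1 ∨ p = (negOne, negOne) := by
  refine (_root_.eq_one_or_eq_negOne (fst_mem hp) h).imp (fun h1 => ?_) fun h1 => ?_
  · exact Prod.ext h1 (snd_eq_one hp h1)
  · have := snd_eq_one (mul_mem hp negOne_mem) (by simp [h1, negOne_mul_negOne])
    refine Prod.ext h1 ?_
    rw [eq_inv_of_mul_eq_one_left this, inv_eq_of_mul_eq_one_left negOne_mul_negOne]

theorem class2C_mul_self {g : Perm (Fin 12 ⊕ Fin 12)} (hg : g ∈ class2C) : g * g = 1 := by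
  obtain ⟨k, -, rfl⟩ := hg
  rw [mul_assoc, mul_assoc, ← mul_assoc k⁻¹, ← mul_assoc k⁻¹, inv_mul_cancel, one_mul,
    ← mul_assoc (Equiv.sumComm _ _ : Perm _), sumComm_mul_self, one_mul, mul_inv_cancel]

theorem exists_eq_of_mem_class2C {g : Perm (Fin 12 ⊕ Fin 12)} (hg : g ∈ class2C) :
    ∃ x y : Perm (Fin 12), g = Perm.sumCongr x y * sumComm (Fin 12) (Fin 12) := by
  obtain ⟨k, hk, rfl⟩ := hg
  -- a factor `sumComm` of the conjugating element does not matter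
  have key : ∃ p : PermPair, k * Equiv.sumComm (Fin 12) (Fin 12) * k⁻¹ =
      Perm.sumCongr p.1 p.2 * sumComm (Fin 12) (Fin 12) * (Perm.sumCongr p.1 p.2)⁻¹ := by
    rcases mem_inner_or_of_mem_M12Dot2 hk with ⟨p, -, rfl⟩ | ⟨p, -, rfl⟩
    · exact ⟨p, rfl⟩
    · exact ⟨p, by group⟩
  obtain ⟨p, hp⟩ := key
  refine ⟨p.1 * p.2⁻¹, p.2 * p.1⁻¹, ?_⟩
  rw [hp, mul_assoc, Perm.sumCongr_inv, sumComm_mul_sumCongr, ← mul_assoc, Perm.sumCongr_mul]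

theorem mul_self_eq_of_class2C {g : Perm (Fin 12 ⊕ Fin 12)} (hg : g ∈ class2C)
    {g' : Perm (SignedLetter ⊕ SignedLetter)} (hg' : g' ∈ M12Dot2Star) (h : LiesAbove₂ g' g) :
    g' * g' = Perm.sumCongr negOne negOne := by
  have hsq : LiesAbove₂ (g' * g') 1 := fun s => by
    rw [← class2C_mul_self hg, Perm.mul_apply, Perm.mul_apply, h, h]
  obtain ⟨x, y, rfl⟩ := exists_eq_of_mem_class2C hg
  rcases mem_inner_or_of_mem_M12Dot2Star hg' with ⟨p, hp, rfl⟩ | ⟨p, hp, rfl⟩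
  · exact absurd (h (Sum.inl (0, 1))) Sum.inl_ne_inr
  · have hp2 : p * p.swap * (negOne, negOne) ∈ M12TildePair :=
      mul_mem (mul_mem hp (M12TildePair.swap_mem hp)) M12TildePair.negOne_mem
    have heq : Perm.sumCongr p.1 p.2 * starSwap * (Perm.sumCongr p.1 p.2 * starSwap) =
        Perm.sumCongrHom _ _ (p * p.swap * (negOne, negOne)) := by
      rw [mul_assoc, ← mul_assoc starSwap,
        starSwap_mul_sumCongr (commute_negOne_of_mem (M12TildePair.snd_mem hp)), mul_assoc,
        starSwap_mul_self, map_mul, map_mul, mul_assoc]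
      rfl
    rw [heq] at hsq ⊢
    rcases M12TildePair.eq_one_or_eq_negOne hp2 fun s =>
      Sum.inl_injective (hsq (Sum.inl s)) with h1 | h1
    · rw [h1, map_one] at heq
      exact absurd heq (mul_self_ne_one_of_outer hp)
    · rw [h1]
      rfl

/-- A permutation whose square is an involution without fixed points has cycles of length four
only. -/
theorem orderOf_and_cycleType_eq_four {α : Type*} [Fintype α] [DecidableEq α] {f ν : Perm α}
    {n : ℕ} (hf : f * f = ν) (hν : ν * ν = 1) (hfix : ∀ x, ν x ≠ x)
    (hcard : Fintype.card α = 4 * n) (hn : n ≠ 0) :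
    orderOf f = 4 ∧ f.cycleType = Multiset.replicate n 4 := by
  have h4 : f ^ 2 ^ (1 + 1) = 1 := by
    rw [show 2 ^ (1 + 1) = 2 * 2 from rfl, pow_mul, pow_two f, hf, pow_two, hν]
  have h := cycleType_eq_replicate Nat.prime_two h4 fun x => by
    rw [pow_one, pow_two, hf]
    exact hfix x
  have hc : f.cycleType.card = n := by omega
  have hct : f.cycleType = Multiset.replicate n 4 := hc ▸ h.2
  refine ⟨?_, hct⟩
  refine orderOf_eq_prime_pow (p := 2) (n := 1) (fun h1 => ?_) h4
  have : Nonempty α := Fintype.card_pos_iff.1 (by omega)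
  refine hfix (Classical.arbitrary α) ?_
  rw [← hf, ← pow_two, ← pow_one 2, h1, Perm.one_apply]

theorem orderOf_and_cycleType_of_class2A {g : Perm (Fin 12)} (hg : g ∈ class2A)
    {g' : Perm SignedLetter} (hg' : g' ∈ M12Tilde) (h : LiesAbove g' g) :
    orderOf g' = 4 ∧ g'.cycleType = Multiset.replicate 6 4 := by
  refine orderOf_and_cycleType_eq_four (mul_self_eq_negOne_of_class2A hg hg' h) negOne_mul_negOne
    (fun s hs => ?_) (by simp [Fintype.card_units_int]) (by norm_num)
  rw [negOne_apply] at hs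
  exact units_ne_neg_self _ (congrArg Prod.snd hs).symm

theorem orderOf_and_cycleType_of_class2C {g : Perm (Fin 12 ⊕ Fin 12)} (hg : g ∈ class2C)
    {g' : Perm (SignedLetter ⊕ SignedLetter)} (hg' : g' ∈ M12Dot2Star) (h : LiesAbove₂ g' g) :
    orderOf g' = 4 ∧ g'.cycleType = Multiset.replicate 12 4 := by
  have hneg : ∀ s, negOne s ≠ s := fun s hs => by
    rw [negOne_apply] at hs
    exact units_ne_neg_self _ (congrArg Prod.snd hs).symm
  refine orderOf_and_cycleType_eq_four (mul_self_eq_of_class2C hg hg' h)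
    (by rw [Perm.sumCongr_mul, negOne_mul_negOne, Perm.sumCongr_one]) ?_
    (by simp [Fintype.card_units_int]) (by norm_num)
  rintro (s | s) hs
  · exact hneg s (Sum.inl_injective hs)
  · exact hneg s (Sum.inr_injective hs)

/-- Homomorphisms from `(2.M₁₂.2)*` to `M₁₂.2` respect the subgroups of index two: with respect to
these, `γ₀` has odd order, and an odd power of `γ₀γ₁` is the square of `starSwap`. -/
theorem map_mem_M12Dot2Inner {π : M12Dot2Star →* Perm (Fin 12 ⊕ Fin 12)}
    (hπ : ∀ g, π g ∈ M12Dot2) {g : M12Dot2Star}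
    (hg : (g : Perm (SignedLetter ⊕ SignedLetter)) ∈ M12Dot2StarInner) :
    π g ∈ M12Dot2Inner := by
  obtain ⟨a, ha⟩ : ∃ a : M12Dot2Star, (a : Perm _) = Perm.sumCongr gen0Tilde gen0Tilde⁻¹ :=
    ⟨⟨_, Subgroup.subset_closure (Or.inl rfl)⟩, rfl⟩
  obtain ⟨b, hb⟩ : ∃ b : M12Dot2Star, (b : Perm _) = Perm.sumCongr gen1Tilde gen1Tilde⁻¹ :=
    ⟨⟨_, Subgroup.subset_closure (Or.inr (Or.inl rfl))⟩, rfl⟩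
  obtain ⟨s, hs⟩ : ∃ s : M12Dot2Star, (s : Perm _) = starSwap := ⟨⟨_, starSwap_mem⟩, rfl⟩
  have ha3 : a ^ (2 * 1 + 1) = 1 := by
    refine Subtype.ext ?_
    rw [Subgroup.coe_pow, ha]
    exact (map_pow (Perm.sumCongrHom _ _) (gen0Tilde, gen0Tilde⁻¹) 3).symm.trans (by
      rw [Prod.pow_mk, inv_pow, gen0Tilde_pow_three, inv_one]; exact map_one _)
  have hab : (a * b) ^ (2 * 5 + 1) = s * s := by
    refine Subtype.ext ?_
    rw [Subgroup.coe_pow, Subgroup.coe_mul, Subgroup.coe_mul, ha, hb, hs, starSwap_mul_self,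
      Perm.sumCongr_mul]
    refine (map_pow (Perm.sumCongrHom _ _)
      (gen0Tilde * gen1Tilde, gen0Tilde⁻¹ * gen1Tilde⁻¹) 11).symm.trans ?_
    rw [Prod.pow_mk, ← M12TildePair.negOne_eq_pow, ← M12TildePair.negOne_eq_pow_inv]
    rfl
  have ha' : π a ∈ M12Dot2Inner := mem_M12Dot2Inner_of_pow (hπ a) (n := 1) (by
    rw [← map_pow, ha3, map_one]; exact one_mem _)
  have hab' : π (a * b) ∈ M12Dot2Inner := mem_M12Dot2Inner_of_pow (hπ _) (n := 5) (by
    rw [← map_pow, hab, map_mul]; exact mul_self_mem_M12Dot2Inner (hπ s))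
  have hb' : π b ∈ M12Dot2Inner := by
    rw [map_mul] at hab'
    exact (Subgroup.mul_mem_cancel_left _ ha').1 hab'
  have hle : M12Dot2StarInner ≤ (M12Dot2Inner.comap π).map M12Dot2Star.subtype := by
    rw [M12Dot2StarInner, M12TildePair, MonoidHom.map_closure, Set.image_pair,
      Subgroup.closure_le]
    rintro x (rfl | rfl)
    · exact ⟨a, ha', ha⟩
    · exact ⟨b, hb', hb⟩
  obtain ⟨g', hg', hgg⟩ := hle hg
  rw [← Subtype.ext hgg]
  exact hg'

/-- The first components give an isomorphism from `M12TildePair` to `2.M₁₂`. -/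
noncomputable def M12TildePair.fstEquiv : M12TildePair ≃* M12Tilde :=
  MulEquiv.ofBijective
    (((MonoidHom.fst (Perm SignedLetter) (Perm SignedLetter)).comp M12TildePair.subtype).codRestrict
      M12Tilde fun p => fst_mem p.2)
    ⟨(injective_iff_map_eq_one _).2 fun p hp => by
        have h1 : p.1.1 = 1 := congrArg Subtype.val hp
        exact Subtype.ext (Prod.ext h1 (snd_eq_one p.2 h1)),
      fun g => by
        obtain ⟨p, hp, hpg⟩ := exists_of_mem g.2
        exact ⟨⟨p, hp⟩, Subtype.ext hpg⟩⟩

/-- Involutions of `(2.M₁₂.2)*` have fixed letters in every action on the letters `e`, `ē` through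
`M₁₂.2`. -/
theorem exists_fixed_of_mul_self_M12Dot2Star {π : M12Dot2Star →* Perm (Fin 12 ⊕ Fin 12)}
    (hπ : ∀ g, π g ∈ M12Dot2) {g : M12Dot2Star} (hgg : g * g = 1) : ∃ i, π g i = i := by
  have hle : ∀ p ∈ M12TildePair, Perm.sumCongrHom _ _ p ∈ M12Dot2Star := fun p hp =>
    M12Dot2StarInner_le ⟨p, hp, rfl⟩
  let j : M12Tilde →* M12Dot2Star :=
    (((Perm.sumCongrHom _ _).comp M12TildePair.subtype).codRestrict M12Dot2Star
      fun p => hle p p.2).comp M12TildePair.fstEquiv.symm.toMonoidHom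
  have hleft : ∀ d i, (π (j d) i).isLeft ↔ i.isLeft := fun d i => by
    obtain ⟨p, -, hp⟩ := map_mem_M12Dot2Inner hπ (g := j d)
      ⟨_, (M12TildePair.fstEquiv.symm d).2, rfl⟩
    rw [← hp]
    cases i <;> rfl
  let φ : M12Tilde →* Perm {i : Fin 12 ⊕ Fin 12 // i.isLeft} :=
    { toFun := fun d => (π (j d)).subtypePerm (hleft d)
      map_one' := Equiv.ext fun i => Subtype.ext (by simp)
      map_mul' := fun c d => Equiv.ext fun i => Subtype.ext
        (DFunLike.congr_fun (by rw [map_mul, map_mul] : π (j (c * d)) = π (j c) * π (j d)) i.1) }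
  obtain ⟨p, hp, hpg⟩ := mem_M12Dot2StarInner_of_mul_self g.2 (congrArg Subtype.val hgg)
  obtain ⟨c, hc⟩ : ∃ c : M12Tilde, c = M12TildePair.fstEquiv ⟨p, hp⟩ := ⟨_, rfl⟩
  have hjc : j c = g := Subtype.ext (by
    rw [hc, ← hpg]
    change Perm.sumCongrHom _ _ (M12TildePair.fstEquiv.symm (M12TildePair.fstEquiv ⟨p, hp⟩)).1 = _
    rw [MulEquiv.symm_apply_apply])
  have hcc : c * c = 1 := by
    have hpp : p * p = 1 := Perm.sumCongrHom_injective (by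
      rw [map_mul, hpg, map_one]
      exact congrArg Subtype.val hgg)
    rw [hc, ← map_mul]
    exact (congrArg _ (Subtype.ext hpp)).trans (map_one _)
  have : Nonempty {i : Fin 12 ⊕ Fin 12 // i.isLeft} := ⟨⟨Sum.inl 0, rfl⟩⟩
  obtain ⟨i, hi⟩ := exists_fixed_of_mul_self (by simp [Fintype.card_subtype]; decide) φ c hcc
  exact ⟨i, by rw [← hjc]; exact congrArg Subtype.val hi⟩

/-! ### The polynomials `f_E(s, x)` with `s²` rational have no real zeros -/

/-- A quartic polynomial `G` without zeros `s` such that `s²` is rational. Separating the even and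
the odd part of `G`, one gets an equation between rational numbers `E(s²)² = s² O(s²)²`, which has
no solutions modulo `17`. -/
theorem quartic_ne_zero {s : ℝ} {r : ℚ} (hr : s ^ 2 = r) :
    273297841336111512458620745064382464 * s ^ 4 - 119390461826733316029395886118289657856 * s ^ 3
      - 1487014117398491580629841956309474947695 * s ^ 2
      + 137763265345868065621416531100008727570254 * s
      - 1134785400733187771748887388257286968289679 ≠ 0 := by
  intro h
  have hq : (273297841336111512458620745064382464 * r ^ 2
      - 1487014117398491580629841956309474947695 * r
      - 1134785400733187771748887388257286968289679) ^ 2 =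
      r * (-119390461826733316029395886118289657856 * r
      + 137763265345868065621416531100008727570254) ^ 2 := by
    have : ((273297841336111512458620745064382464 * r ^ 2
      - 1487014117398491580629841956309474947695 * r
      - 1134785400733187771748887388257286968289679) ^ 2 : ℝ) =
      r * (-119390461826733316029395886118289657856 * r
      + 137763265345868065621416531100008727570254) ^ 2 := by
      rw [← hr]
      linear_combination (273297841336111512458620745064382464 * s ^ 4
        - 1487014117398491580629841956309474947695 * s ^ 2
        - 1134785400733187771748887388257286968289679
        - s * (-119390461826733316029395886118289657856 * s ^ 2
          + 137763265345868065621416531100008727570254)) * h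
    exact_mod_cast this
  have hz : (273297841336111512458620745064382464 * r.num ^ 2
      - 1487014117398491580629841956309474947695 * r.num * r.den
      - 1134785400733187771748887388257286968289679 * r.den ^ 2) ^ 2 =
      r.num * r.den * (-119390461826733316029395886118289657856 * r.num
      + 137763265345868065621416531100008727570254 * r.den) ^ 2 := by
    have hd : (r.den : ℚ) ≠ 0 := by exact_mod_cast r.den_ne_zero
    have hn : (r.num : ℚ) = r * r.den := (Rat.mul_den_eq_num r).symm
    have : ((273297841336111512458620745064382464 * r.num ^ 2
      - 1487014117398491580629841956309474947695 * r.num * r.den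
      - 1134785400733187771748887388257286968289679 * r.den ^ 2) ^ 2 : ℚ) =
      r.num * r.den * (-119390461826733316029395886118289657856 * r.num
      + 137763265345868065621416531100008727570254 * r.den) ^ 2 := by
      rw [hn]
      linear_combination (r.den : ℚ) ^ 4 * hq
    exact_mod_cast this
  have h17 : ∀ p q : ZMod 17, (15 * p ^ 2 + 2 * p * q + 11 * q ^ 2) ^ 2 =
      p * q * (9 * p + 8 * q) ^ 2 → p = 0 ∧ q = 0 := by
    decide +kernel
  have hpq := h17 r.num r.den (by
    have := congrArg (Int.cast : ℤ → ZMod 17) hz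
    push_cast at this
    have e4 : (273297841336111512458620745064382464 : ZMod 17) = 15 := by reduce_mod_char
    have e3 : (119390461826733316029395886118289657856 : ZMod 17) = -9 := by reduce_mod_char
    have e2 : (1487014117398491580629841956309474947695 : ZMod 17) = -2 := by reduce_mod_char
    have e1 : (137763265345868065621416531100008727570254 : ZMod 17) = 8 := by reduce_mod_char
    have e0 : (1134785400733187771748887388257286968289679 : ZMod 17) = -11 := by reduce_mod_char
    rw [e4, e3, e2, e1, e0] at this
    linear_combination this)
  have hp : (17 : ℤ) ∣ r.num := (ZMod.intCast_zmod_eq_zero_iff_dvd _ 17).1 hpq.1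
  have hq' : 17 ∣ r.den := (ZMod.natCast_eq_zero_iff _ 17).1 hpq.2
  have := Nat.dvd_gcd (Int.natAbs_dvd_natAbs.2 hp) hq'
  rw [Nat.Coprime.gcd_eq_one r.reduced] at this
  exact absurd this (by decide)

/-- The polynomial `f_E(s, x)` is a sum of two squares, the second one multiplied by a positive
quadratic polynomial. -/
theorem polyE_eq (s x : ℝ) : polyE s x =
    (8696754 * s + (x ^ 6 - 4410 * x ^ 4 + 46308 * x ^ 3 + 1947657 * x ^ 2 - 24189396 * x
      - 31133822)) ^ 2 +
    16 * ((x - 20) ^ 2 + 4) * (24 * x ^ 4 + 324 * x ^ 3 - 23255 * x ^ 2 - 91036 * x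
      + 2152241) ^ 2 := by
  rw [polyE]
  ring

/-- The polynomial `f_E(s, x)` has no real zeros when `s²` is rational. At a real zero, both squares
vanish: `x` is a zero of a quartic polynomial, and `s` is an element of the quartic field generated
by `x`, with characteristic polynomial proportional to that of `quartic_ne_zero`. -/
theorem polyE_ne_zero_of_sq_eq_ratCast {s : ℝ} {r : ℚ} (hr : s ^ 2 = r) (x : ℝ) :
    polyE s x ≠ 0 := by
  intro h
  rw [polyE_eq] at h
  have hpos : 0 < 16 * ((x - 20) ^ 2 + 4) := by positivity
  have hR : 24 * x ^ 4 + 324 * x ^ 3 - 23255 * x ^ 2 - 91036 * x + 2152241 = 0 := by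
    by_contra hne
    have := mul_pos hpos (sq_pos_of_ne_zero hne)
    nlinarith [sq_nonneg (8696754 * s + (x ^ 6 - 4410 * x ^ 4 + 46308 * x ^ 3 + 1947657 * x ^ 2
      - 24189396 * x - 31133822))]
  have hs : 8696754 * s + (x ^ 6 - 4410 * x ^ 4 + 46308 * x ^ 3 + 1947657 * x ^ 2 - 24189396 * x
      - 31133822) = 0 := by
    rw [hR, zero_pow two_ne_zero, mul_zero, add_zero] at h
    exact pow_eq_zero_iff two_ne_zero |>.1 h
  -- `s` is an element of the quartic field generated by `x`
  have hsx : s = (-46664016 * x ^ 3 + 778095821 * x ^ 2 + 20355782608 * x - 150395839379) /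
      5009330304 := by
    linear_combination (576 * hs + (-24 * x ^ 2 + 324 * x + 78211) * hR) / 5009330304
  refine quartic_ne_zero hr ?_
  rw [hsx]
  -- the factor is the quotient of the quartic polynomial in `s` by the one in `x`
  linear_combination (85750119287103249594270816 * x ^ 8
    - 6876963708798501791208785000 * x ^ 7
    + 677414457016444160132410579001 / 4 * x ^ 6
    + 690264278717918090249737052227457 / 288 * x ^ 5
    - 9884876347651157404188332172616420175 / 55296 * x ^ 4
    + 109545634741992085805115862765976979701 / 110592 * x ^ 3
    + 59576382767271472628381957644638483592945 / 1327104 * x ^ 2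
    - 99134773496421775637204420291601798172633 / 331776 * x
    - 1947384963820383354545103460770698129857927 / 1327104) * hR

/-! ### Galois action on labels and complex conjugation -/

theorem apply_galRep {ι K : Type*} [CommRing K] [Algebra ℚ K] (e : ι ≃ (K →ₐ[ℚ] QBar)) (σ : GalQ)
    (i : ι) (x : K) : e (galRep e σ i) x = σ (e i x) := by
  simp [galRep, galAction]
  rfl

theorem complexConj_mul_self : complexConj * complexConj = 1 := by
  ext z
  rw [AlgEquiv.mul_apply, complexConj_apply, complexConj_apply, Complex.conj_conj,
    AlgEquiv.one_apply]

theorem exists_real_of_complexConj_eq {z : QBar} (hz : complexConj z = z) :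
    ∃ y : ℝ, (z : ℂ) = y := by
  rw [← Complex.conj_eq_iff_real, ← complexConj_apply, hz]

theorem map_polyE {R S : Type*} [CommRing R] [CommRing S] (f : R →+* S) (s x : R) :
    f (polyE s x) = polyE (f s) (f x) := by
  simp [polyE, map_ofNat]

theorem map_polyE2 {R S : Type*} [CommRing R] [CommRing S] (f : R →+* S) (t x : R) :
    f (polyE2 t x) = polyE2 (f t) (f x) := by
  simp [polyE2, map_ofNat]

theorem map_polyA {R S : Type*} [CommRing R] [CommRing S] (f : R →+* S) (a t x : R) :
    f (polyA a t x) = polyA (f a) (f t) (f x) := by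
  simp [polyA, map_ofNat]

theorem map_polyC {R S : Type*} [CommRing R] [CommRing S] (f : R →+* S) (u t x : R) :
    f (polyC u t x) = polyC (f u) (f t) (f x) := by
  simp [polyC, map_ofNat]

theorem map_polyD {R S : Type*} [CommRing R] [CommRing S] (f : R →+* S) (u t x : R) :
    f (polyD u t x) = polyD (f u) (f t) (f x) := by
  simp [polyD, map_ofNat]

theorem root_injective (p : ℚ[X]) :
    Function.Injective fun ψ : AdjoinRoot p →ₐ[ℚ] QBar => ψ (AdjoinRoot.root p) :=
  fun _ _ h => AdjoinRoot.algHom_ext h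

theorem polyE_root {τ : ℚ} (ψ : KE τ →ₐ[ℚ] QBar) :
    polyE (algebraMap ℚ QBar τ) (ψ (AdjoinRoot.root _)) = 0 := by
  have h := AdjoinRoot.aeval_algHom_eq_zero _ ψ
  rw [← AlgHom.coe_toRingHom, map_polyE] at h
  simpa using h

theorem polyE2_root {τ : ℚ} (ψ : KE2 τ →ₐ[ℚ] QBar) :
    polyE2 (algebraMap ℚ QBar τ) (ψ (AdjoinRoot.root _)) = 0 := by
  have h := AdjoinRoot.aeval_algHom_eq_zero _ ψ
  rw [← AlgHom.coe_toRingHom, map_polyE2] at h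
  simpa using h

/-- A parameter with rational square gives a polynomial without zeros in `ℚ̄ ∩ ℝ`. -/
theorem polyE_ne_zero_of_complexConj_eq {s z : QBar} {r : ℚ} (hr : s ^ 2 = algebraMap ℚ QBar r)
    (hs : complexConj s = s) (hz : complexConj z = z) : polyE s z ≠ 0 := by
  intro h
  obtain ⟨y, hy⟩ := exists_real_of_complexConj_eq hz
  obtain ⟨t, ht⟩ := exists_real_of_complexConj_eq hs
  have htr : t ^ 2 = r := by
    have := congrArg (algebraMap QBar ℂ) hr
    rw [map_pow, ← IsScalarTower.algebraMap_apply] at this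
    change (s : ℂ) ^ 2 = _ at this
    rw [ht, eq_ratCast] at this
    exact_mod_cast this
  refine polyE_ne_zero_of_sq_eq_ratCast htr y (Complex.ofReal_injective ?_)
  have h2 := congrArg (algebraMap QBar ℂ) h
  rw [map_polyE, map_zero] at h2
  change polyE (s : ℂ) (z : ℂ) = 0 at h2
  rw [ht, hy] at h2
  exact (map_polyE Complex.ofRealHom t y).trans (h2.trans (map_zero Complex.ofRealHom).symm)

/-- None of the embeddings of `K(E,τ)` is real. -/
theorem galAction_complexConj_ne {τ : ℚ} (ψ : KE τ →ₐ[ℚ] QBar) :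
    galAction (KE τ) complexConj ψ ≠ ψ := fun h =>
  polyE_ne_zero_of_complexConj_eq (r := τ ^ 2) (map_pow _ _ _).symm (complexConj.commutes τ)
    (DFunLike.congr_fun h (AdjoinRoot.root _)) (polyE_root ψ)

theorem eval_polyE {k : Type*} [CommRing k] (s z : k) :
    (polyE (C s) X : k[X]).eval z = polyE s z :=
  (map_polyE (evalRingHom z) _ _).trans (by simp)

theorem natDegree_polyE_le {k : Type*} [Field k] [CharZero k] (s : k) :
    (polyE (C s) X : k[X]).natDegree ≤ 12 := by
  unfold polyE
  compute_degree

theorem polyE_X_ne_zero {k : Type*} [Field k] [CharZero k] (s : k) :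
    (polyE (C s) X : k[X]) ≠ 0 := by
  have : (polyE (C s) X : k[X]).coeff 12 = 1 := by
    unfold polyE
    compute_degree!
  intro h
  rw [h, coeff_zero] at this
  exact zero_ne_one this

theorem natDegree_polyA_le {k : Type*} [Field k] [CharZero k] (a t : k) :
    (polyA (C a) (C t) X : k[X]).natDegree ≤ 12 := by
  unfold polyA
  compute_degree

theorem polyA_X_ne_zero {k : Type*} [Field k] [CharZero k] (a t : k) :
    (polyA (C a) (C t) X : k[X]) ≠ 0 := by
  have : (polyA (C a) (C t) X : k[X]).coeff 12 = -125 := by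
    unfold polyA
    compute_degree!
  intro h
  rw [h, coeff_zero] at this
  norm_num at this

theorem natDegree_polyC_le {k : Type*} [Field k] [CharZero k] (u t : k) :
    (polyC (C u) (C t) X : k[X]).natDegree ≤ 12 := by
  unfold polyC
  compute_degree

theorem polyC_X_ne_zero {k : Type*} [Field k] [CharZero k] (u t : k) :
    (polyC (C u) (C t) X : k[X]) ≠ 0 := by
  have : (polyC (C u) (C t) X : k[X]).coeff 12 = 16 := by
    unfold polyC
    compute_degree!
  intro h
  rw [h, coeff_zero] at this
  norm_num at this

theorem natDegree_polyD_le {k : Type*} [Field k] [CharZero k] (u t : k) :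
    (polyD (C u) (C t) X : k[X]).natDegree ≤ 12 := by
  unfold polyD
  compute_degree

theorem polyD_X_ne_zero {k : Type*} [Field k] [CharZero k] {u : k} (hu : u ≠ 0) (t : k) :
    (polyD (C u) (C t) X : k[X]) ≠ 0 := by
  have : (polyD (C u) (C t) X : k[X]).coeff 12 = -11 ^ 2 * 594 ^ 3 * u := by
    unfold polyD
    compute_degree!
    ring
  intro h
  rw [h, coeff_zero] at this
  exact mul_ne_zero (by norm_num) hu this.symm

theorem card_le_of_eval_eq_zero {ι k : Type*} [Fintype ι] [Field k] {x : ι → k}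
    (hx : Function.Injective x) {p : k[X]} (hp : p ≠ 0) {n : ℕ} (hn : p.natDegree ≤ n)
    (h : ∀ i, p.eval (x i) = 0) : Fintype.card ι ≤ n := by
  classical
  calc Fintype.card ι = (Finset.univ.image x).card := by
        rw [Finset.card_image_of_injective _ hx, Finset.card_univ]
    _ ≤ p.natDegree := card_le_degree_of_subset_roots (by
        intro z hz
        obtain ⟨i, -, rfl⟩ := Finset.mem_image.1 hz
        exact (mem_roots hp).2 (h i))
    _ ≤ n := hn

/-- The `24` embeddings correspond to the zeros of `f s` and `f (-s)`, which have degree at most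
`12`. An automorphism with `σ s = -s` interchanges the two sets of zeros, so that it cannot fix all
embeddings. -/
theorem apply_eq_of_galRep_eq_one {K : Type*} [CommRing K] [Algebra ℚ K]
    (e : (Fin 12 ⊕ Fin 12) ≃ (K →ₐ[ℚ] QBar)) {θ : K}
    (hθ : Function.Injective fun ψ : K →ₐ[ℚ] QBar => ψ θ) {f : QBar → QBar[X]} {s : QBar}
    (h0 : f (-s) ≠ 0) (hdeg : (f (-s)).natDegree ≤ 12)
    (hf : ∀ (σ : GalQ) t z, σ ((f t).eval z) = (f (σ t)).eval (σ z))
    (hroot : ∀ ψ : K →ₐ[ℚ] QBar, (f s).eval (ψ θ) = 0 ∨ (f (-s)).eval (ψ θ) = 0)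
    {σ : GalQ} (hs : σ s = s ∨ σ s = -s) (hσ : galRep e σ = 1) : σ s = s := by
  classical
  refine hs.resolve_right fun hs => ?_
  have hx : Function.Injective fun i => e i θ := hθ.comp e.injective
  let S (t : QBar) : Finset (Fin 12 ⊕ Fin 12) := {i | (f t).eval (e i θ) = 0}
  have hcard : (S (-s)).card ≤ 12 := by
    rw [← Fintype.card_coe]
    exact card_le_of_eval_eq_zero (x := fun i : S (-s) => e i θ) (hx.comp Subtype.val_injective)
      h0 hdeg fun i => (Finset.mem_filter.1 i.2).2
  -- an automorphism that fixes all labels but not `s` makes the two sets of zeros coincide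
  have hsub : S s ⊆ S (-s) := fun i hi => by
    have hi' := congrArg σ (Finset.mem_filter.1 hi).2
    rw [hf, hs, map_zero, ← apply_galRep, hσ] at hi'
    exact Finset.mem_filter.2 ⟨Finset.mem_univ _, hi'⟩
  have huniv : Finset.univ ⊆ S (-s) := fun i _ =>
    (hroot (e i)).elim (fun h => hsub (Finset.mem_filter.2 ⟨Finset.mem_univ _, h⟩))
      fun h => Finset.mem_filter.2 ⟨Finset.mem_univ _, h⟩
  have := (Finset.card_le_card huniv).trans hcard
  simp at this

/-- Suppose that automorphisms that fix all labels fix `s`, and that complex conjugation does not.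
Then the latter is an outer element: the elements `γ₀` and `γ₀γ₁` generate `M₁₂` and have odd
order, so that automorphisms which act in this way on the labels fix `s`. -/
theorem galRep_complexConj_notMem_inner {K : Type*} [CommRing K] [Algebra ℚ K]
    {e : (Fin 12 ⊕ Fin 12) ≃ (K →ₐ[ℚ] QBar)} (he : (galRep e).range = M12Dot2) {s : QBar}
    (hs : ∀ σ : GalQ, σ s = s ∨ σ s = -s) (hker : ∀ σ : GalQ, galRep e σ = 1 → σ s = s)
    (hc : complexConj s ≠ s) : galRep e complexConj ∉ M12Dot2Inner := by
  let N := MulAction.stabilizer GalQ s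
  have hsq : ∀ σ : GalQ, σ * σ ∈ N := fun σ => by
    change σ (σ s) = s
    rcases hs σ with h | h <;> simp [h]
  have hodd : ∀ σ : GalQ, ∀ n, galRep e σ ^ (2 * n + 1) = 1 → σ ∈ N := fun σ n h => by
    rw [← map_pow] at h
    have h1 : σ ^ (2 * n + 1) ∈ N := hker _ h
    rw [pow_succ, pow_mul, pow_two] at h1
    exact (Subgroup.mul_mem_cancel_left _ (pow_mem (hsq σ) n)).1 h1
  have hex : ∀ g ∈ M12Dot2, ∃ σ, galRep e σ = g := fun g hg => by
    rw [← he] at hg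
    exact hg
  obtain ⟨α, hα⟩ := hex (Perm.sumCongr gen0 gen0⁻¹) (Subgroup.subset_closure (Or.inl rfl))
  obtain ⟨β, hβ⟩ := hex (Perm.sumCongr gen1 gen1⁻¹) (Subgroup.subset_closure (Or.inr (Or.inl rfl)))
  have hαN : α ∈ N := hodd α 1 (by rw [hα]; decide +kernel)
  have hβN : β ∈ N := (Subgroup.mul_mem_cancel_left _ hαN).1
    (hodd (α * β) 5 (by rw [map_mul, hα, hβ]; decide +kernel))
  have hle : M12Dot2Inner ≤ N.map (galRep e) := by
    rw [M12Dot2Inner, M12Pair, MonoidHom.map_closure, Set.image_pair, Subgroup.closure_le]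
    rintro x (rfl | rfl)
    · exact ⟨α, hαN, hα⟩
    · exact ⟨β, hβN, hβ⟩
  intro hin
  obtain ⟨σ, hσ, hσc⟩ := hle hin
  have h1 : σ⁻¹ * complexConj ∈ N := hker _ (by rw [map_mul, map_inv, hσc, inv_mul_cancel])
  exact hc ((Subgroup.mul_mem_cancel_left _ (inv_mem hσ)).1 h1)

theorem apply_eq_or_eq_neg {s : QBar} {r : ℚ} (hs : s ^ 2 = algebraMap ℚ QBar r) (σ : GalQ) :
    σ s = s ∨ σ s = -s := by
  rw [← sq_eq_sq_iff_eq_or_eq_neg, ← map_pow, hs, σ.commutes]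

theorem complexConj_ne_of_sq_neg {s : QBar} {r : ℚ} (hs : s ^ 2 = algebraMap ℚ QBar r)
    (hr : r < 0) : complexConj s ≠ s := fun h => by
  obtain ⟨t, ht⟩ := exists_real_of_complexConj_eq h
  have htr : t ^ 2 = r := by
    have := congrArg (algebraMap QBar ℂ) hs
    rw [map_pow, ← IsScalarTower.algebraMap_apply] at this
    change (s : ℂ) ^ 2 = _ at this
    rw [ht, eq_ratCast] at this
    exact_mod_cast this
  have : (r : ℝ) < 0 := by exact_mod_cast hr
  nlinarith [sq_nonneg t]

theorem exists_sq_eq (r : ℚ) : ∃ s : QBar, s ^ 2 = algebraMap ℚ QBar r := by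
  have : IsAlgClosed QBar := IsAlgClosure.isAlgClosed ℚ
  exact IsAlgClosed.exists_pow_nat_eq _ two_pos

/-! ### Quadratic resolvents of the fields `K(L2,τ)` and `K(E2,τ)` -/

/-- The specialization of `√q` to a square root `s` of `q` and of `x` to `z`. -/
noncomputable def quadraticEval (z s : QBar) {q : ℚ[X]} (hs : s * s = aeval z q) :
    QuadraticAlgebra ℚ[X] q 0 →+* QBar where
  toFun w := aeval z w.re + aeval z w.im * s
  map_one' := by simp only [QuadraticAlgebra.re_one, QuadraticAlgebra.im_one, map_one,
      map_zero, zero_mul, add_zero]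
  map_zero' := by simp only [QuadraticAlgebra.re_zero, QuadraticAlgebra.im_zero, map_zero]; ring
  map_add' v w := by simp only [QuadraticAlgebra.re_add, QuadraticAlgebra.im_add, map_add]; ring
  map_mul' v w := by
    simp only [QuadraticAlgebra.re_mul, QuadraticAlgebra.im_mul, map_add, map_mul, ← hs, map_zero]
    ring

theorem aeval_norm (z s : QBar) {q : ℚ[X]} (hs : s * s = aeval z q) (hs' : -s * -s = aeval z q)
    (w : QuadraticAlgebra ℚ[X] q 0) :
    aeval z (QuadraticAlgebra.norm w) = quadraticEval z s hs w * quadraticEval z (-s) hs' w := by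
  simp only [QuadraticAlgebra.norm_def, quadraticEval, RingHom.coe_mk, MonoidHom.coe_mk,
    OneHom.coe_mk, map_add, map_sub, map_mul, map_zero, ← hs]
  ring

theorem quadraticEval_omega (z s : QBar) {q : ℚ[X]} (hs : s * s = aeval z q) :
    quadraticEval z s hs ⟨0, 1⟩ = s := by
  simp [quadraticEval]

theorem quadraticEval_C (z s : QBar) {q : ℚ[X]} (hs : s * s = aeval z q) (p : ℚ[X]) :
    quadraticEval z s hs (.C p) = aeval z p := by
  simp [quadraticEval]

/-- The discriminant of the quadratic field over which `f_{L2}` factors. -/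
def ImaginaryCover.disc : ImaginaryCover → ℚ
  | .A => -5
  | .C => -11
  | .D => -11

/-- The polynomial `f_L(τ,x)`, with `s` in the place of the square root of `L.disc`. -/
noncomputable def ImaginaryCover.factor (L : ImaginaryCover) (τ : ℚ) (s : QBar) : QBar[X] :=
  match L with
  | .A => polyA (Polynomial.C s) (Polynomial.C (algebraMap ℚ QBar τ)) X
  | .C => polyC (Polynomial.C s) (Polynomial.C (algebraMap ℚ QBar τ)) X
  | .D => polyD (Polynomial.C s) (Polynomial.C (algebraMap ℚ QBar τ)) X

theorem ImaginaryCover.natDegree_factor_le (L : ImaginaryCover) (τ : ℚ) (s : QBar) :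
    (L.factor τ s).natDegree ≤ 12 := by
  cases L
  · exact natDegree_polyA_le _ _
  · exact natDegree_polyC_le _ _
  · exact natDegree_polyD_le _ _

theorem ImaginaryCover.factor_ne_zero (L : ImaginaryCover) (τ : ℚ) {s : QBar} (hs : s ≠ 0) :
    L.factor τ s ≠ 0 := by
  cases L
  · exact polyA_X_ne_zero _ _
  · exact polyC_X_ne_zero _ _
  · exact polyD_X_ne_zero hs _

theorem ImaginaryCover.eval_factor (L : ImaginaryCover) (τ : ℚ) (s z : QBar) :
    (L.factor τ s).eval z = match L with
      | .A => polyA s (algebraMap ℚ QBar τ) z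
      | .C => polyC s (algebraMap ℚ QBar τ) z
      | .D => polyD s (algebraMap ℚ QBar τ) z := by
  rw [← coe_evalRingHom]
  cases L
  · exact (map_polyA _ _ _ _).trans (by simp)
  · exact (map_polyC _ _ _ _).trans (by simp)
  · exact (map_polyD _ _ _ _).trans (by simp)

theorem ImaginaryCover.map_eval_factor (L : ImaginaryCover) (τ : ℚ) (σ : GalQ) (s z : QBar) :
    σ ((L.factor τ s).eval z) = (L.factor τ (σ s)).eval (σ z) := by
  rw [eval_factor, eval_factor]
  cases L
  · exact (map_polyA (σ : QBar →+* QBar) _ _ _).trans (by simp)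
  · exact (map_polyC (σ : QBar →+* QBar) _ _ _).trans (by simp)
  · exact (map_polyD (σ : QBar →+* QBar) _ _ _).trans (by simp)

theorem ImaginaryCover.aeval_polyL2 (L : ImaginaryCover) (τ : ℚ) {s : QBar}
    (hs : s ^ 2 = algebraMap ℚ QBar L.disc) (z : QBar) :
    aeval z (polyL2 L τ) = (L.factor τ s).eval z * (L.factor τ (-s)).eval z := by
  rw [eval_factor, eval_factor]
  cases L
  · have hs1 : s * s = aeval z (-5 : ℚ[X]) := by simpa [← pow_two, disc, map_ofNat] using hs
    have hs2 : -s * -s = aeval z (-5 : ℚ[X]) := by rw [neg_mul_neg, hs1]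
    refine (aeval_norm z s hs1 hs2 _).trans ?_
    rw [map_polyA, map_polyA]
    simp only [quadraticEval_omega, quadraticEval_C, aeval_C, aeval_X]
  · have hs1 : s * s = aeval z (-11 : ℚ[X]) := by simpa [← pow_two, disc, map_ofNat] using hs
    have hs2 : -s * -s = aeval z (-11 : ℚ[X]) := by rw [neg_mul_neg, hs1]
    refine (aeval_norm z s hs1 hs2 _).trans ?_
    rw [map_polyC, map_polyC]
    simp only [quadraticEval_omega, quadraticEval_C, aeval_C, aeval_X]
  · have hs1 : s * s = aeval z (-11 : ℚ[X]) := by simpa [← pow_two, disc, map_ofNat] using hs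
    have hs2 : -s * -s = aeval z (-11 : ℚ[X]) := by rw [neg_mul_neg, hs1]
    refine (aeval_norm z s hs1 hs2 _).trans ?_
    rw [map_polyD, map_polyD]
    simp only [quadraticEval_omega, quadraticEval_C, aeval_C, aeval_X]

theorem galRep_complexConj_notMem_inner_L2 (L : ImaginaryCover) (τ : ℚ)
    {e : (Fin 12 ⊕ Fin 12) ≃ (KL2 L τ →ₐ[ℚ] QBar)} (he : (galRep e).range = M12Dot2) :
    galRep e complexConj ∉ M12Dot2Inner := by
  have hneg : L.disc < 0 := by cases L <;> norm_num [ImaginaryCover.disc]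
  obtain ⟨s, hs⟩ := exists_sq_eq L.disc
  have hs0 : s ≠ 0 := by
    rintro rfl
    rw [zero_pow two_ne_zero, eq_comm, map_eq_zero] at hs
    exact hneg.ne hs
  refine galRep_complexConj_notMem_inner he (apply_eq_or_eq_neg hs) (fun σ hσ => ?_)
    (complexConj_ne_of_sq_neg hs hneg)
  refine apply_eq_of_galRep_eq_one e (root_injective _) (f := L.factor τ)
    (L.factor_ne_zero τ (neg_ne_zero.2 hs0)) (L.natDegree_factor_le τ _) (L.map_eval_factor τ)
    (fun ψ => ?_) (apply_eq_or_eq_neg hs σ) hσ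
  rw [← mul_eq_zero, ← L.aeval_polyL2 τ hs]
  exact AdjoinRoot.aeval_algHom_eq_zero _ ψ

theorem polyE_mul_polyE_neg_root {τ : ℚ} {s : QBar}
    (hs : s ^ 2 = algebraMap ℚ QBar (11 * (τ - 1))) (ψ : KE2 τ →ₐ[ℚ] QBar) :
    polyE s (ψ (AdjoinRoot.root _)) = 0 ∨ polyE (-s) (ψ (AdjoinRoot.root _)) = 0 := by
  rw [← mul_eq_zero, polyE_mul_polyE_neg, hs, ← polyE2_root ψ]
  congr 1
  rw [map_mul, map_sub, map_one, map_ofNat]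
  ring

theorem galRep_complexConj_notMem_inner_E2 {τ : ℚ} (hτ : τ < 1)
    {e : (Fin 12 ⊕ Fin 12) ≃ (KE2 τ →ₐ[ℚ] QBar)} (he : (galRep e).range = M12Dot2) :
    galRep e complexConj ∉ M12Dot2Inner := by
  have hneg : 11 * (τ - 1) < 0 := by linarith
  obtain ⟨s, hs⟩ := exists_sq_eq (11 * (τ - 1))
  refine galRep_complexConj_notMem_inner he (apply_eq_or_eq_neg hs) (fun σ hσ => ?_)
    (complexConj_ne_of_sq_neg hs hneg)
  refine apply_eq_of_galRep_eq_one e (root_injective _) (f := fun t => polyE (C t) X)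
    (polyE_X_ne_zero _) (natDegree_polyE_le _) (fun σ t z => ?_)
    (fun ψ => ?_) (apply_eq_or_eq_neg hs σ) hσ
  · rw [eval_polyE, eval_polyE]
    exact map_polyE (σ : QBar →+* QBar) _ _
  · rw [eval_polyE, eval_polyE]
    exact polyE_mul_polyE_neg_root hs ψ

/-- For `τ > 1`, no embedding of `K(E2,τ)` is real. -/
theorem galRep_complexConj_ne {τ : ℚ} (hτ : 1 < τ) (e : (Fin 12 ⊕ Fin 12) ≃ (KE2 τ →ₐ[ℚ] QBar))
    (i : Fin 12 ⊕ Fin 12) : galRep e complexConj i ≠ i := by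
  intro hi
  have hz : complexConj (e i (AdjoinRoot.root _)) = e i (AdjoinRoot.root _) := by
    rw [← apply_galRep, hi]
  obtain ⟨s, hs⟩ := exists_sq_eq (11 * (τ - 1))
  have hsC : (s : ℂ) ^ 2 = ((11 * (τ - 1) : ℚ) : ℂ) := by
    have := congrArg (algebraMap QBar ℂ) hs
    rwa [map_pow, ← IsScalarTower.algebraMap_apply, eq_ratCast] at this
  have hcs : complexConj s = s := by
    refine (apply_eq_or_eq_neg hs complexConj).resolve_right fun h => ?_
    have him : (starRingEnd ℂ) (s : ℂ) = -s := by rw [← complexConj_apply, h]; rfl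
    have hre : (s : ℂ).re = 0 := by
      have := congrArg Complex.re him
      rw [Complex.conj_re, Complex.neg_re] at this
      linarith
    have h2 : (s : ℂ).re ^ 2 - (s : ℂ).im ^ 2 = 11 * (τ - 1) := by
      have := congrArg Complex.re hsC
      rw [Complex.ratCast_re, pow_two, Complex.mul_re, ← pow_two, ← pow_two] at this
      rw [this]
      push_cast
      ring
    rw [hre] at h2
    have : (1 : ℝ) < τ := by exact_mod_cast hτ
    nlinarith [sq_nonneg (s : ℂ).im]
  rcases polyE_mul_polyE_neg_root hs (e i) with h | h
  · exact polyE_ne_zero_of_complexConj_eq hs hcs hz h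
  · exact polyE_ne_zero_of_complexConj_eq (s := -s) (by rw [neg_sq, hs]) (by rw [map_neg, hcs]) hz h

/-! ### Embeddings into fields with a given Galois group -/

theorem MonoidHom.exists_comp_eq {G H K : Type*} [Group G] [Group H] [Group K] {ρ : G →* H}
    (hρ : Function.Surjective ρ) {φ : G →* K} (h : ∀ σ, ρ σ = 1 → φ σ = 1) :
    ∃ π : H →* K, ∀ σ, π (ρ σ) = φ σ :=
  ⟨ρ.liftOfSurjective hρ ⟨φ, fun σ hσ => h σ hσ⟩,
    fun σ => ρ.liftOfRightInverse_comp_apply _ (Function.rightInverse_surjInv hρ) _ σ⟩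

theorem HasGaloisGroup.exists_surjective {F : Type*} [Field F] [NumberField F] {G : Type*} [Group G]
    (h : HasGaloisGroup F G) :
    ∃ ρ : GalQ →* G, Function.Surjective ρ ∧ ∀ σ, ρ σ = 1 → galAction F σ = 1 := by
  obtain ⟨θ⟩ := h
  refine ⟨θ.toMonoidHom.comp (galAction F).rangeRestrict,
    θ.surjective.comp (galAction F).rangeRestrict_surjective, fun σ hσ => ?_⟩
  exact congrArg Subtype.val (θ.map_eq_one_iff.1 hσ)

theorem galAction_comp {K F : Type*} [CommRing K] [Algebra ℚ K] [CommRing F] [Algebra ℚ F]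
    (f : K →ₐ[ℚ] F) (σ : GalQ) (ψ : F →ₐ[ℚ] QBar) :
    galAction K σ (ψ.comp f) = (galAction F σ ψ).comp f := rfl

theorem nonempty_embedding (F : Type*) [Field F] [NumberField F] : Nonempty (F →ₐ[ℚ] QBar) := by
  have : IsAlgClosed QBar := IsAlgClosure.isAlgClosed ℚ
  exact ⟨IsAlgClosed.lift⟩

/-- The field `K(E,τ)` does not embed in a field `F` with group `2.M₁₂`: complex conjugation would
fix one of the at most twelve embeddings that extend to `F`. -/
theorem isEmpty_algHom_of_hasGaloisGroup_M12Tilde (τ : ℚ) (F : Type*) [Field F] [NumberField F]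
    (hF : HasGaloisGroup F M12Tilde) : IsEmpty (KE τ →ₐ[ℚ] F) := by
  refine ⟨fun f => ?_⟩
  obtain ⟨ρ, hρ, hker⟩ := hF.exists_surjective
  obtain ⟨ψ₀⟩ := nonempty_embedding F
  let S : Set (KE τ →ₐ[ℚ] QBar) := Set.range fun ψ : F →ₐ[ℚ] QBar => ψ.comp f
  have hS : ∀ σ ψ, galAction (KE τ) σ ψ ∈ S ↔ ψ ∈ S := by
    have h1 : ∀ σ, ∀ ψ ∈ S, galAction (KE τ) σ ψ ∈ S := by
      rintro σ _ ⟨ψ, rfl⟩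
      exact ⟨galAction F σ ψ, (galAction_comp f σ ψ).symm⟩
    refine fun σ ψ => ⟨fun h => ?_, h1 σ ψ⟩
    have h2 := h1 σ⁻¹ _ h
    rwa [← Perm.mul_apply, ← map_mul, inv_mul_cancel, map_one] at h2
  let φ : GalQ →* Perm S :=
    { toFun := fun σ => (galAction (KE τ) σ).subtypePerm (hS σ)
      map_one' := Equiv.ext fun _ => rfl
      map_mul' := fun _ _ => Equiv.ext fun _ => rfl }
  obtain ⟨π, hπ⟩ := MonoidHom.exists_comp_eq hρ (φ := φ) fun σ hσ => by
    ext ⟨_, ψ, rfl⟩ : 2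
    change galAction (KE τ) σ (ψ.comp f) = ψ.comp f
    rw [galAction_comp, hker σ hσ, Perm.one_apply]
  have : Fintype S := Fintype.ofFinite S
  have : Nonempty S := ⟨⟨ψ₀.comp f, ψ₀, rfl⟩⟩
  have hcard : Fintype.card S ≤ 12 := by
    refine card_le_of_eval_eq_zero (x := fun ψ : S => ψ.1 (AdjoinRoot.root _))
      ((root_injective _).comp Subtype.val_injective) (polyE_X_ne_zero (algebraMap ℚ QBar τ))
      (natDegree_polyE_le _) fun ψ => ?_
    rw [eval_polyE]
    exact polyE_root ψ.1
  obtain ⟨ψ, hψ⟩ := exists_fixed_of_mul_self hcard π (ρ complexConj)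
    (by rw [← map_mul, complexConj_mul_self, map_one])
  rw [hπ] at hψ
  exact galAction_complexConj_ne ψ.1 (congrArg Subtype.val hψ)

/-- An embedding of an `M₁₂.2` field in a field with group `(2.M₁₂.2)*` gives a homomorphism from
`(2.M₁₂.2)*` to `M₁₂.2` that describes the Galois action. -/
theorem exists_hom_M12Dot2Star {K : Type*} [CommRing K] [Algebra ℚ K]
    {e : (Fin 12 ⊕ Fin 12) ≃ (K →ₐ[ℚ] QBar)} (he : (galRep e).range = M12Dot2) {F : Type*} [Field F]
    [NumberField F] (hF : HasGaloisGroup F M12Dot2Star) (f : K →ₐ[ℚ] F) :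
    ∃ (ρ : GalQ →* M12Dot2Star) (π : M12Dot2Star →* Perm (Fin 12 ⊕ Fin 12)),
      (∀ g, π g ∈ M12Dot2) ∧ ∀ σ, π (ρ σ) = galRep e σ := by
  obtain ⟨ρ, hρ, hker⟩ := hF.exists_surjective
  obtain ⟨ψ₀⟩ := nonempty_embedding F
  -- all embeddings of `K` extend to `F`
  have hext : ∀ i, ∃ ψ : F →ₐ[ℚ] QBar, e i = ψ.comp f := fun i => by
    obtain ⟨g, hg, hgi⟩ := exists_mem_M12Dot2_apply_eq (e.symm (ψ₀.comp f)) i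
    rw [← he] at hg
    obtain ⟨σ, rfl⟩ := hg
    refine ⟨galAction F σ ψ₀, ?_⟩
    rw [← galAction_comp, ← hgi]
    ext x
    rw [apply_galRep, e.apply_symm_apply]
    rfl
  obtain ⟨π, hπ⟩ := MonoidHom.exists_comp_eq hρ (φ := galRep e) fun σ hσ => by
    ext i : 1
    obtain ⟨ψ, hψ⟩ := hext i
    refine e.injective (AlgHom.ext fun x => ?_)
    have h1 : galAction F σ ψ = ψ := by rw [hker σ hσ, Perm.one_apply]
    rw [apply_galRep, Perm.one_apply, hψ]
    exact DFunLike.congr_fun h1 (f x)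
  refine ⟨ρ, π, fun g => ?_, hπ⟩
  obtain ⟨σ, rfl⟩ := hρ g
  rw [hπ, ← he]
  exact ⟨σ, rfl⟩

/-- If complex conjugation is an outer element of `M₁₂.2`, there is no field with group
`(2.M₁₂.2)*` above `K`, as the involutions of `(2.M₁₂.2)*` are inner. -/
theorem isEmpty_algHom_of_notMem_inner {K : Type*} [CommRing K] [Algebra ℚ K]
    {e : (Fin 12 ⊕ Fin 12) ≃ (K →ₐ[ℚ] QBar)} (he : (galRep e).range = M12Dot2)
    (hc : galRep e complexConj ∉ M12Dot2Inner) {F : Type*} [Field F]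
    [NumberField F] (hF : HasGaloisGroup F M12Dot2Star) : IsEmpty (K →ₐ[ℚ] F) := by
  refine ⟨fun f => ?_⟩
  obtain ⟨ρ, π, hπ, h⟩ := exists_hom_M12Dot2Star he hF f
  have hρ : ρ complexConj * ρ complexConj = 1 := by rw [← map_mul, complexConj_mul_self, map_one]
  rw [← h] at hc
  exact hc (map_mem_M12Dot2Inner hπ
    (mem_M12Dot2StarInner_of_mul_self (ρ complexConj).2 (congrArg Subtype.val hρ)))

/-- If complex conjugation fixes no label, there is no field with group `(2.M₁₂.2)*` above `K`. -/
theorem isEmpty_algHom_of_forall_ne {K : Type*} [CommRing K] [Algebra ℚ K]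
    {e : (Fin 12 ⊕ Fin 12) ≃ (K →ₐ[ℚ] QBar)} (he : (galRep e).range = M12Dot2)
    (hc : ∀ i, galRep e complexConj i ≠ i) {F : Type*} [Field F]
    [NumberField F] (hF : HasGaloisGroup F M12Dot2Star) : IsEmpty (K →ₐ[ℚ] F) := by
  refine ⟨fun f => ?_⟩
  obtain ⟨ρ, π, hπ, h⟩ := exists_hom_M12Dot2Star he hF f
  have hρ : ρ complexConj * ρ complexConj = 1 := by rw [← map_mul, complexConj_mul_self, map_one]
  obtain ⟨i, hi⟩ := exists_fixed_of_mul_self_M12Dot2Star hπ hρ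
  exact hc i (by rw [← h, hi])

theorem complexConj_mem_class2A {τ : ℚ} (e : Fin 12 ≃ (KE τ →ₐ[ℚ] QBar))
    (he : (galRep e).range ≤ M12) :
    galRep e complexConj ∈ class2A ∧
      (galRep e complexConj).cycleType = Multiset.replicate 6 2 := by
  obtain ⟨g, hg⟩ : ∃ g, g = galRep e complexConj := ⟨_, rfl⟩
  have hgg : g * g = 1 := by rw [hg, ← map_mul, complexConj_mul_self, map_one]
  have hfix : ∀ i, g i ≠ i := fun i hi => galAction_complexConj_ne (e i) <| AlgHom.ext fun x => by
    rw [hg] at hi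
    exact (apply_galRep e complexConj i x).symm.trans (by rw [hi])
  rw [← hg]
  constructor
  · have h1 : g ≠ 1 := fun h => hfix 0 (by rw [h]; rfl)
    refine (involution_of_mem_M12 (he ⟨_, hg.symm⟩) hgg h1).resolve_right ?_
    -- the conjugates of `gen1` have fixed letters
    rintro ⟨h, -, rfl⟩
    refine hfix (h 1) ?_
    have h1 : gen1 1 = 1 := by decide
    simp [h1]
  · have h := cycleType_eq_replicate Nat.prime_two (f := g) (n := 0)
      (by rw [zero_add, pow_one, pow_two, hgg]) (by simpa using hfix)
    have hc : g.cycleType.card = 6 := by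
      have := h.1
      rw [Fintype.card_fin] at this
      omega
    rw [h.2, hc]
    rfl

theorem not_exists_lift {τ : GalQ → Perm (Fin 12)} (h : τ complexConj ∈ class2A) :
    ¬ ∃ ρ : GalQ →* M12Tilde, ∀ σ, LiesAbove (ρ σ : Perm SignedLetter) (τ σ) := by
  rintro ⟨ρ, hρ⟩
  have h1 : ρ complexConj * ρ complexConj = 1 := by rw [← map_mul, complexConj_mul_self, map_one]
  exact negOne_ne_one ((mul_self_eq_negOne_of_class2A h (ρ complexConj).2 (hρ _)).symm.trans
    (congrArg Subtype.val h1))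

theorem galRep_complexConj_mem_class2C {K : Type*} [CommRing K] [Algebra ℚ K]
    {e : (Fin 12 ⊕ Fin 12) ≃ (K →ₐ[ℚ] QBar)} (he : (galRep e).range = M12Dot2)
    (hc : galRep e complexConj ∉ M12Dot2Inner) : galRep e complexConj ∈ class2C :=
  mem_class2C (by rw [← he]; exact ⟨_, rfl⟩)
    (by rw [← map_mul, complexConj_mul_self, map_one]) hc

theorem mainTheorem4 :
    -- the elements of `2.M₁₂` above the class `2A` of `M₁₂` have order 4 (cycle type `4⁶`),
    -- and they form a single conjugacy class
    (∀ g ∈ class2A, ∀ g' ∈ M12Tilde, LiesAbove g' g →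
      orderOf g' = 4 ∧ g'.cycleType = Multiset.replicate 6 4) ∧
    (∀ g ∈ class2A, ∀ g' ∈ M12Tilde, LiesAbove g' g →
      ∀ h ∈ class2A, ∀ h' ∈ M12Tilde, LiesAbove h' h → ∃ k ∈ M12Tilde, k * g' * k⁻¹ = h') ∧
    -- complex conjugation on the `M₁₂` algebra `K(E,τ)` is in the class `2A`, of cycle type `2⁶`,
    -- and the Galois representation does not lift to `2.M₁₂`
    (∀ (τ : ℚ) (e : Fin 12 ≃ (KE τ →ₐ[ℚ] QBar)), (galRep e).range ≤ M12 →
      galRep e complexConj ∈ class2A ∧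
      (galRep e complexConj).cycleType = Multiset.replicate 6 2 ∧
      ¬ ∃ ρ : GalQ →* M12Tilde, ∀ σ, LiesAbove (ρ σ : Perm SignedLetter) (galRep e σ)) ∧
    -- `K(E,τ)` does not embed in a field with Galois group `2.M₁₂`
    (∀ (τ : ℚ) (F : Type*) [Field F] [NumberField F], HasGaloisGroup F M12Tilde →
      IsEmpty (KE τ →ₐ[ℚ] F)) ∧
    -- the elements of `(2.M₁₂.2)*` above the class `2C` of `M₁₂.2` have order 4
    (∀ g ∈ class2C, ∀ g' ∈ M12Dot2Star, LiesAbove₂ g' g →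
      orderOf g' = 4 ∧ g'.cycleType = Multiset.replicate 12 4) ∧
    -- an `M₁₂.2` field `K(L2,τ)`, for `L = A, C, D`, has complex conjugation in the class `2C`
    -- and does not embed in a field with Galois group `(2.M₁₂.2)*`
    (∀ (L : ImaginaryCover) (τ : ℚ), τ ≠ 0 → τ ≠ 1 →
      ∀ e : (Fin 12 ⊕ Fin 12) ≃ (KL2 L τ →ₐ[ℚ] QBar), (galRep e).range = M12Dot2 →
        galRep e complexConj ∈ class2C ∧
        ∀ (F : Type*) [Field F] [NumberField F], HasGaloisGroup F M12Dot2Star →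
          IsEmpty (KL2 L τ →ₐ[ℚ] F)) ∧
    -- an `M₁₂.2` field `K(E2,τ)` does not embed in a field with Galois group `(2.M₁₂.2)*` either
    (∀ τ : ℚ, τ ≠ 0 → τ ≠ 1 →
      ∀ e : (Fin 12 ⊕ Fin 12) ≃ (KE2 τ →ₐ[ℚ] QBar), (galRep e).range = M12Dot2 →
        ∀ (F : Type*) [Field F] [NumberField F], HasGaloisGroup F M12Dot2Star →
          IsEmpty (KE2 τ →ₐ[ℚ] F)) := by
  refine ⟨fun g hg g' hg' h => orderOf_and_cycleType_of_class2A hg hg' h, ?_, ?_,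
    isEmpty_algHom_of_hasGaloisGroup_M12Tilde,
    fun g hg g' hg' h => orderOf_and_cycleType_of_class2C hg hg' h, ?_, ?_⟩
  · intro g hg g' hg' hgg h hh h' hh' hhh
    obtain ⟨k, hk, rfl⟩ := exists_conj_of_class2A hg hg' hgg
    obtain ⟨l, hl, rfl⟩ := exists_conj_of_class2A hh hh' hhh
    exact ⟨l * k⁻¹, mul_mem hl (inv_mem hk), by group⟩
  · intro τ e he
    obtain ⟨h1, h2⟩ := complexConj_mem_class2A e he
    exact ⟨h1, h2, not_exists_lift h1⟩
  · intro L τ _ _ e he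
    have hc := galRep_complexConj_notMem_inner_L2 L τ he
    exact ⟨galRep_complexConj_mem_class2C he hc,
      fun F _ _ hF => isEmpty_algHom_of_notMem_inner he hc hF⟩
  · intro τ _ hτ e he F _ _ hF
    rcases hτ.lt_or_gt with h | h
    · exact isEmpty_algHom_of_notMem_inner he (galRep_complexConj_notMem_inner_E2 h he) hF
    · exact isEmpty_algHom_of_forall_ne he (galRep_complexConj_ne h e) hF
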